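/- Let $\Omega\subseteq\mathbb{R}^5$ be a non-empty connected open set with coordinates $(t,x,y,z,u)$, and let $I\subseteq\mathbb{R}$ be the open interval of values that the coordinate $x$ takes on $\Omega$. Let $H,G:I\to\mathbb{R}$ be $C^\infty$ functions with $G+H^2>0$ on $I$, and let $D:I\to\mathbb{R}$ be a continuous (hence $C^\infty$ and nowhere zero) function with $D^2=G+H^2$. Consider on $\Omega$ the five-dimensional Riemannian Gödel-type metric, of signature $(+,-,-,-,-)$, $$ds^2 = dt^2 + 2H(x)\,dt\,dy - dx^2 - G(x)\,dy^2 - dz^2 - du^2 .$$ Call $(\Omega, ds^2)$ locally homogeneous if for any two points $p,q\in\Omega$ there are open neighbourhoods $U\subseteq\Omega$ of $p$ and $V\subseteq\Omega$ of $q$ and a $C^\infty$ diffeomorphism $\Phi:U\to V$ with $\Phi(p)=q$ that is an isometry of the metric. Then $(\Omega, ds^2)$ is locally homogeneous if and only if the functions $H'/D$ and $D''/D$ are both constant on $I$, that is, if and only if there are real constants $\omega$ and $m^2$ (the symbol $m^2$ denotes a real number of either sign or zero) such that $$\frac{H'(x)}{D(x)}=-2\omega \qquad\text{and}\qquad \frac{D''(x)}{D(x)}=m^2\qquad\text{for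 all } x\in I .$$ -/

import Mathlib

open scoped ContDiff

namespace GodelType

/-- Coordinate space `ℝ⁵`. A point is `p = (t, x, y, z, u)`; in particular `p 1` is the
`x`-coordinate. -/
abbrev Coord : Type := Fin 5 → ℝ

/-- A field of bilinear forms on (a part of) coordinate space: a metric tensor in coordinates.
`g p v w` is the value at the point `p` on the tangent vectors `v`, `w`. -/
abbrev MetricField : Type := Coord → LinearMap.BilinForm ℝ Coord

/-- The matrix of components `g_{μν}` at a point with `x`-coordinate `x` of the line element
`ds² = dt² + 2 H(x) dt dy - dx² - G(x) dy² - dz² - du²`, in the coordinates `(t, x, y, z, u)`. -/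
def components (H G : ℝ → ℝ) (x : ℝ) : Matrix (Fin 5) (Fin 5) ℝ :=
  !![1,   0,  H x,    0,  0;
     0,   -1, 0,      0,  0;
     H x, 0,  -(G x), 0,  0;
     0,   0,  0,      -1, 0;
     0,   0,  0,      0,  -1]

/-- The Gödel-type metric with coefficient functions `H` and `G`. -/
noncomputable def metric (H G : ℝ → ℝ) : MetricField :=
  fun p => Matrix.toBilin' (components H G (p 1))

/-- `Φ` is an isometry for `g` from an open subset of `Ω` onto an open subset of `Ω`:
a diffeomorphism from its (open) source onto its (open) target, smooth in both directions,
both contained in `Ω`, whose differential preserves `g`. -/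
structure IsIsometryIn (g : MetricField) (Ω : Set Coord)
    (Φ : OpenPartialHomeomorph Coord Coord) : Prop where
  source_subset : Φ.source ⊆ Ω
  target_subset : Φ.target ⊆ Ω
  contDiffOn : ContDiffOn ℝ ∞ Φ Φ.source
  contDiffOn_symm : ContDiffOn ℝ ∞ Φ.symm Φ.target
  map_metric : ∀ p ∈ Φ.source, ∀ v w : Coord,
    g (Φ p) (fderiv ℝ Φ p v) (fderiv ℝ Φ p w) = g p v w

/-- `(Ω, g)` is locally homogeneous: for any two points of `Ω` there is an isometry from an open
neighbourhood of the first onto an open neighbourhood of the second that maps the first point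
to the second. -/
def LocallyHomogeneous (g : MetricField) (Ω : Set Coord) : Prop :=
  ∀ p ∈ Ω, ∀ q ∈ Ω, ∃ Φ : OpenPartialHomeomorph Coord Coord,
    IsIsometryIn g Ω Φ ∧ p ∈ Φ.source ∧ Φ p = q

/-- The range of the `x`-coordinate on `Ω`. -/
def xRange (Ω : Set Coord) : Set ℝ := (fun p : Coord => p 1) '' Ω

end GodelType

namespace GodelType


/-! Write f = H'/D and k = D''/D. The metric is (dt + H dy)² - (dx² + D² dy²) - dz² - du². The
surface metric dx² + D² dy² has Gaussian curvature -k, and the exterior derivative of dt + H dy is f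
times its area form D dx∧dy.

Necessity (`constants_of_locallyHomogeneous`): an isometry preserves the Ricci tensor
(`IsLocalIsometryOn.ricci_map`), hence conjugates the Ricci operators at corresponding points. Local
homogeneity therefore makes their characteristic polynomial independent of the point. The trace is
2k - f²/2, and ∂x is an eigenvector with eigenvalue k - f²/2. This eigenvalue is continuous in x and
stays among the finitely many roots of one polynomial, so it is constant. Hence k and f² are
constant, and continuity fixes the sign of f.

Sufficiency (`locallyHomogeneous_of_constants`): if f = l and k = m are constant, every point has a
chart onto a neighbourhood of the origin in one fixed model (`exists_chart`), and one chart followed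
by the inverse of another is the required isometry (`locallyHomogeneous_of_charts`). The surface is
mapped explicitly onto the quadric e² - m(a² + b²) = 1 (`modelForm_pullback`). The time coordinate
is shifted by a primitive of the difference of two one-forms, which is closed because both have
exterior derivative l times the area form (`closedness_identity`, `exists_primitive`). -/

/-! ### Levi-Civita connection and curvature under local isometries. -/

/-- The algebra behind uniqueness of the Levi-Civita connection: alternating the two symmetries six
times returns to the same triple with the opposite sign. -/
lemma eq_zero_of_symm_of_antisymm {E : Type*} {T : E → E → E → ℝ} (h1 : ∀ z v w, T z v w = T v z w)
    (h2 : ∀ z v w, T z v w = -T z w v) (z v w : E) : T z v w = 0 := by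
  linarith [h1 z v w, h2 v z w, h1 v w z, h2 w v z, h1 w z v, h2 z w v]

section LeviCivita

variable {E : Type*} [NormedAddCommGroup E] [NormedSpace ℝ E]

/-- `Γ` is the field of Christoffel symbols of the Levi-Civita connection of the metric `g`
on the set `Ω`: it is torsion-free and differentiates `g` to zero. -/
structure IsLeviCivita (g : E → E →L[ℝ] E →L[ℝ] ℝ) (Γ : E → E →L[ℝ] E →L[ℝ] E)
    (Ω : Set E) : Prop where
  torsion_free : ∀ p ∈ Ω, ∀ v w, Γ p v w = Γ p w v
  differentiableAt : ∀ p ∈ Ω, DifferentiableAt ℝ g p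
  compatible : ∀ p ∈ Ω, ∀ z v w, fderiv ℝ g p z v w = g p (Γ p z v) w + g p v (Γ p z w)

/-- `R(v, w) z` at the point `p`, for the connection with Christoffel symbols `Γ`. -/
noncomputable def curvature (Γ : E → E →L[ℝ] E →L[ℝ] E) (p : E) (v w z : E) : E :=
  fderiv ℝ Γ p v w z - fderiv ℝ Γ p w v z + Γ p v (Γ p w z) - Γ p w (Γ p v z)

/-- A smooth map on the open set `U ⊆ Ω`, with values in `Ω`, that preserves the metric `g`. -/
structure IsLocalIsometryOn (g : E → E →L[ℝ] E →L[ℝ] ℝ) (Ω U : Set E) (Φ : E → E) : Prop where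
  isOpen : IsOpen U
  subset : U ⊆ Ω
  mapsTo : Set.MapsTo Φ U Ω
  contDiffOn : ContDiffOn ℝ ∞ Φ U
  map_metric : ∀ p ∈ U, ∀ v w, g (Φ p) (fderiv ℝ Φ p v) (fderiv ℝ Φ p w) = g p v w

variable {g : E → E →L[ℝ] E →L[ℝ] ℝ} {Γ : E → E →L[ℝ] E →L[ℝ] E} {Ω U : Set E} {Φ : E → E}

lemma IsLocalIsometryOn.fderiv_injective (hΦ : IsLocalIsometryOn g Ω U Φ)
    (hnd : ∀ p ∈ Ω, ∀ v, (∀ w, g p v w = 0) → v = 0) {p : E} (hp : p ∈ U) :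
    Function.Injective (fderiv ℝ Φ p) := by
  rw [injective_iff_map_eq_zero]
  intro v hv
  refine hnd p (hΦ.subset hp) v fun w => ?_
  rw [← hΦ.map_metric p hp, hv]
  simp

lemma IsLocalIsometryOn.fderiv_surjective [FiniteDimensional ℝ E]
    (hΦ : IsLocalIsometryOn g Ω U Φ)
    (hnd : ∀ p ∈ Ω, ∀ v, (∀ w, g p v w = 0) → v = 0) {p : E} (hp : p ∈ U) :
    Function.Surjective (fderiv ℝ Φ p) :=
  (LinearMap.injective_iff_surjective (f := (fderiv ℝ Φ p : E →ₗ[ℝ] E))).1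
    (hΦ.fderiv_injective hnd hp)

lemma IsLocalIsometryOn.differentiableAt (hΦ : IsLocalIsometryOn g Ω U Φ) {p : E} (hp : p ∈ U) :
    DifferentiableAt ℝ Φ p :=
  (hΦ.contDiffOn.contDiffAt (hΦ.isOpen.mem_nhds hp)).differentiableAt (by simp)

lemma IsLocalIsometryOn.contDiffOn_fderiv (hΦ : IsLocalIsometryOn g Ω U Φ) :
    ContDiffOn ℝ ∞ (fderiv ℝ Φ) U :=
  ((contDiffOn_infty_iff_fderiv_of_isOpen hΦ.isOpen).1 hΦ.contDiffOn).2

lemma IsLocalIsometryOn.contDiffOn_fderiv_fderiv (hΦ : IsLocalIsometryOn g Ω U Φ) :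
    ContDiffOn ℝ ∞ (fderiv ℝ (fderiv ℝ Φ)) U :=
  ((contDiffOn_infty_iff_fderiv_of_isOpen hΦ.isOpen).1 hΦ.contDiffOn_fderiv).2

/-- The transformation law of the Christoffel symbols under an isometry. -/
lemma IsLocalIsometryOn.fderiv_christoffel [FiniteDimensional ℝ E]
    (hΦ : IsLocalIsometryOn g Ω U Φ) (hΓ : IsLeviCivita g Γ Ω)
    (hsymm : ∀ p ∈ Ω, ∀ v w, g p v w = g p w v)
    (hnd : ∀ p ∈ Ω, ∀ v, (∀ w, g p v w = 0) → v = 0) {p : E} (hp : p ∈ U) (v w : E) :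
    fderiv ℝ Φ p (Γ p v w) =
      Γ (Φ p) (fderiv ℝ Φ p v) (fderiv ℝ Φ p w) + fderiv ℝ (fderiv ℝ Φ) p v w := by
  have hpΩ := hΦ.subset hp
  have hqΩ := hΦ.mapsTo hp
  have hsym2 : ∀ v w, fderiv ℝ (fderiv ℝ Φ) p v w = fderiv ℝ (fderiv ℝ Φ) p w v :=
    (hΦ.contDiffOn.contDiffAt (hΦ.isOpen.mem_nhds hp)).isSymmSndFDerivAt
      (by rw [minSmoothness_of_isRCLikeNormedField]; exact WithTop.coe_le_coe.2 le_top)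
  have hd2 : HasFDerivAt (fderiv ℝ Φ) (fderiv ℝ (fderiv ℝ Φ) p) p :=
    ((hΦ.contDiffOn_fderiv.contDiffAt (hΦ.isOpen.mem_nhds hp)).differentiableAt
      (by simp)).hasFDerivAt
  have hd1 : HasFDerivAt Φ (fderiv ℝ Φ p) p := (hΦ.differentiableAt hp).hasFDerivAt
  -- The isometry equation differentiated in the direction z, with v and w held constant.
  have key : ∀ z v w,
      fderiv ℝ g (Φ p) (fderiv ℝ Φ p z) (fderiv ℝ Φ p v) (fderiv ℝ Φ p w)
        + g (Φ p) (fderiv ℝ (fderiv ℝ Φ) p z v) (fderiv ℝ Φ p w)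
        + g (Φ p) (fderiv ℝ Φ p v) (fderiv ℝ (fderiv ℝ Φ) p z w) = fderiv ℝ g p z v w := by
    intro z v w
    have hg : HasFDerivAt (fun r => g (Φ r)) ((fderiv ℝ g (Φ p)).comp (fderiv ℝ Φ p)) p :=
      HasFDerivAt.comp (G := E →L[ℝ] E →L[ℝ] ℝ) (g := g) p (hΓ.differentiableAt (Φ p) hqΩ).hasFDerivAt hd1
    have h1 := (hg.clm_apply (hd2.clm_apply (hasFDerivAt_const v p))).clm_apply
      (hd2.clm_apply (hasFDerivAt_const w p))
    have h2 := ((hΓ.differentiableAt p hpΩ).hasFDerivAt.clm_apply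
      (hasFDerivAt_const v p)).clm_apply (hasFDerivAt_const w p)
    have h3 := h1.congr_of_eventuallyEq (f₁ := fun p => g p v w) (by
      filter_upwards [hΦ.isOpen.mem_nhds hp] with r hr
      exact (hΦ.map_metric r hr v w).symm)
    have := congrArg (fun L => L z) (h3.unique h2)
    simp at this
    linarith
  -- N is the defect in the transformation law. It is symmetric since both connections are
  -- torsion-free, and g(N(z, v), dΦ w) is antisymmetric in v, w since both are metric; so it
  -- vanishes.
  set N : E → E → E := fun v w => Γ (Φ p) (fderiv ℝ Φ p v) (fderiv ℝ Φ p w)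
      + fderiv ℝ (fderiv ℝ Φ) p v w - fderiv ℝ Φ p (Γ p v w) with hN
  have hNs : ∀ v w, N v w = N w v := by
    intro v w
    simp only [hN, hsym2 v w, hΓ.torsion_free p hpΩ v w, hΓ.torsion_free _ hqΩ (fderiv ℝ Φ p v)]
  have hNa : ∀ z v w, g (Φ p) (N z v) (fderiv ℝ Φ p w) + g (Φ p) (fderiv ℝ Φ p v) (N z w) = 0 := by
    intro z v w
    have h := key z v w
    rw [hΓ.compatible _ hqΩ, hΓ.compatible _ hpΩ, ← hΦ.map_metric p hp (Γ p z v),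
      ← hΦ.map_metric p hp v] at h
    simp only [hN, map_add, map_sub, add_apply, sub_apply]
    linarith
  have hT := eq_zero_of_symm_of_antisymm (T := fun z v w => g (Φ p) (N z v) (fderiv ℝ Φ p w))
    (fun z v w => by simp only [hNs z v])
    (fun z v w => by
      have := hNa z v w
      rw [hsymm _ hqΩ (fderiv ℝ Φ p v)] at this
      linarith)
  have : N v w = 0 := by
    refine hnd _ hqΩ _ fun y => ?_
    obtain ⟨y, rfl⟩ := hΦ.fderiv_surjective hnd hp y
    exact hT v w y
  exact (sub_eq_zero.1 this).symm

/-- Isometries preserve the curvature tensor. -/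
lemma IsLocalIsometryOn.fderiv_curvature [FiniteDimensional ℝ E]
    (hΦ : IsLocalIsometryOn g Ω U Φ) (hΓ : IsLeviCivita g Γ Ω)
    (hsymm : ∀ p ∈ Ω, ∀ v w, g p v w = g p w v)
    (hnd : ∀ p ∈ Ω, ∀ v, (∀ w, g p v w = 0) → v = 0)
    (hdΓ : ∀ p ∈ Ω, DifferentiableAt ℝ Γ p) {p : E} (hp : p ∈ U) (v w z : E) :
    fderiv ℝ Φ p (curvature Γ p v w z) =
      curvature Γ (Φ p) (fderiv ℝ Φ p v) (fderiv ℝ Φ p w) (fderiv ℝ Φ p z) := by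
  have hpΩ := hΦ.subset hp
  have hqΩ := hΦ.mapsTo hp
  have law := fun {p : E} (hp : p ∈ U) => hΦ.fderiv_christoffel hΓ hsymm hnd hp
  have hsym2 : ∀ v w, fderiv ℝ (fderiv ℝ Φ) p v w = fderiv ℝ (fderiv ℝ Φ) p w v :=
    (hΦ.contDiffOn.contDiffAt (hΦ.isOpen.mem_nhds hp)).isSymmSndFDerivAt
      (by rw [minSmoothness_of_isRCLikeNormedField]; exact WithTop.coe_le_coe.2 le_top)
  have hsym3 : ∀ v w, fderiv ℝ (fderiv ℝ (fderiv ℝ Φ)) p v w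
      = fderiv ℝ (fderiv ℝ (fderiv ℝ Φ)) p w v :=
    (hΦ.contDiffOn_fderiv.contDiffAt (hΦ.isOpen.mem_nhds hp)).isSymmSndFDerivAt
      (by rw [minSmoothness_of_isRCLikeNormedField]; exact WithTop.coe_le_coe.2 le_top)
  have hd1 : HasFDerivAt Φ (fderiv ℝ Φ p) p := (hΦ.differentiableAt hp).hasFDerivAt
  have hd2 : HasFDerivAt (fderiv ℝ Φ) (fderiv ℝ (fderiv ℝ Φ) p) p :=
    ((hΦ.contDiffOn_fderiv.contDiffAt (hΦ.isOpen.mem_nhds hp)).differentiableAt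
      (by simp)).hasFDerivAt
  have hd3 : HasFDerivAt (fderiv ℝ (fderiv ℝ Φ)) (fderiv ℝ (fderiv ℝ (fderiv ℝ Φ)) p) p :=
    ((hΦ.contDiffOn_fderiv_fderiv.contDiffAt (hΦ.isOpen.mem_nhds hp)).differentiableAt
      (by simp)).hasFDerivAt
  -- The transformation law of the Christoffel symbols, differentiated in the direction v.
  have key : ∀ v w z, fderiv ℝ (fderiv ℝ Φ) p v (Γ p w z) + fderiv ℝ Φ p (fderiv ℝ Γ p v w z)
      = fderiv ℝ Γ (Φ p) (fderiv ℝ Φ p v) (fderiv ℝ Φ p w) (fderiv ℝ Φ p z)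
        + Γ (Φ p) (fderiv ℝ (fderiv ℝ Φ) p v w) (fderiv ℝ Φ p z)
        + Γ (Φ p) (fderiv ℝ Φ p w) (fderiv ℝ (fderiv ℝ Φ) p v z)
        + fderiv ℝ (fderiv ℝ (fderiv ℝ Φ)) p v w z := by
    intro v w z
    have hc := fun y : E => hasFDerivAt_const (𝕜 := ℝ) y p
    have h1 := hd2.clm_apply (((hdΓ p hpΩ).hasFDerivAt.clm_apply (hc w)).clm_apply (hc z))
    have h2 := ((((hdΓ _ hqΩ).hasFDerivAt.comp p hd1).clm_apply
      (hd2.clm_apply (hc w))).clm_apply (hd2.clm_apply (hc z))).add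
      ((hd3.clm_apply (hc w)).clm_apply (hc z))
    have h3 := h2.congr_of_eventuallyEq (f₁ := fun p => fderiv ℝ Φ p (Γ p w z)) (by
      filter_upwards [hΦ.isOpen.mem_nhds hp] with r hr
      exact law hr w z)
    have := congrArg (fun L => L v) (h1.unique h3)
    simp at this
    rw [add_comm, this]
    abel
  -- Antisymmetrising in v, w cancels the third derivatives of Φ and the term Γ(D²Φ(v, w)). The
  -- remaining second derivatives are absorbed by applying the law to Γ(v, Γ(w, z)) and Γ(w, Γ(v,
  -- z)).
  have k1 := key v w z
  have k2 := key w v z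
  have k3 := law hp v (Γ p w z)
  have k4 := law hp w (Γ p v z)
  rw [law hp w z, map_add] at k3
  rw [law hp v z, map_add] at k4
  rw [hsym2 w v, hsym3 w v] at k2
  simp only [curvature, map_add, map_sub, k3, k4, eq_sub_of_add_eq' k1, eq_sub_of_add_eq' k2]
  abel

/-- The Ricci tensor: `Ric(w, z)` is the trace of `v ↦ R(v, w) z`. -/
noncomputable def ricci (Γ : E → E →L[ℝ] E →L[ℝ] E) (p : E) (w z : E) : ℝ :=
  LinearMap.trace ℝ E
    { toFun := fun v => curvature Γ p v w z
      map_add' := fun v v' => by simp [curvature]; abel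
      map_smul' := fun r v => by simp [curvature, smul_sub, smul_add] }

/-- The differential of Φ conjugates v ↦ R(v, w) z into the corresponding map at the image point,
and the trace is invariant under conjugation. -/
lemma IsLocalIsometryOn.ricci_map [FiniteDimensional ℝ E]
    (hΦ : IsLocalIsometryOn g Ω U Φ) (hΓ : IsLeviCivita g Γ Ω)
    (hsymm : ∀ p ∈ Ω, ∀ v w, g p v w = g p w v)
    (hnd : ∀ p ∈ Ω, ∀ v, (∀ w, g p v w = 0) → v = 0)
    (hdΓ : ∀ p ∈ Ω, DifferentiableAt ℝ Γ p) {p : E} (hp : p ∈ U) (w z : E) :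
    ricci Γ (Φ p) (fderiv ℝ Φ p w) (fderiv ℝ Φ p z) = ricci Γ p w z := by
  let e : E ≃ₗ[ℝ] E := LinearEquiv.ofBijective (fderiv ℝ Φ p : E →ₗ[ℝ] E)
    ⟨hΦ.fderiv_injective hnd hp, hΦ.fderiv_surjective hnd hp⟩
  symm
  rw [ricci, ricci, ← LinearMap.trace_conj' _ e]
  congr 1
  ext v
  obtain ⟨v, rfl⟩ := e.surjective v
  simp only [LinearEquiv.conj_apply_apply, LinearEquiv.symm_apply_apply]
  exact hΦ.fderiv_curvature hΓ hsymm hnd hdΓ hp v w z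

end LeviCivita


/-! ### Christoffel symbols and Ricci tensor of the Gödel-type metric. -/

lemma metric_apply (H G : ℝ → ℝ) (p v w : Coord) :
    metric H G p v w = v 0 * w 0 + H (p 1) * (v 0 * w 2 + v 2 * w 0) - v 1 * w 1
      - G (p 1) * (v 2 * w 2) - v 3 * w 3 - v 4 * w 4 := by
  simp [metric, components, Matrix.toBilin'_apply', dotProduct, Matrix.mulVec, Fin.sum_univ_five]
  ring

/-- The bilinear form `(v, w) ↦ vᵢ wⱼ`. -/
noncomputable def coordForm (i j : Fin 5) : Coord →L[ℝ] Coord →L[ℝ] ℝ :=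
  (ContinuousLinearMap.proj i : Coord →L[ℝ] ℝ).smulRight (ContinuousLinearMap.proj j)

/-- The symmetric bilinear map `(v, w) ↦ (vᵢ wⱼ + vⱼ wᵢ) eₖ`. -/
noncomputable def symmForm (i j k : Fin 5) : Coord →L[ℝ] Coord →L[ℝ] Coord :=
  (ContinuousLinearMap.proj i : Coord →L[ℝ] ℝ).smulRight
      ((ContinuousLinearMap.proj j : Coord →L[ℝ] ℝ).smulRight (Pi.single k (1 : ℝ))) +
    (ContinuousLinearMap.proj j : Coord →L[ℝ] ℝ).smulRight
      ((ContinuousLinearMap.proj i : Coord →L[ℝ] ℝ).smulRight (Pi.single k (1 : ℝ)))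

@[simp] lemma coordForm_apply (i j : Fin 5) (v w : Coord) : coordForm i j v w = v i * w j := rfl

@[simp] lemma symmForm_apply (i j k : Fin 5) (v w : Coord) :
    symmForm i j k v w = (v i * w j + v j * w i) • Pi.single k (1 : ℝ) := by
  simp [symmForm, add_smul, smul_smul]

/-- The metric form whose coefficients `g_{ty}`, `g_{yy}` are `h` and `h² - d²`. -/
noncomputable def metricForm (h d : ℝ) : Coord →L[ℝ] Coord →L[ℝ] ℝ :=
  coordForm 0 0 - coordForm 1 1 - coordForm 3 3 - coordForm 4 4
    + h • (coordForm 0 2 + coordForm 2 0) + (h ^ 2 - d ^ 2) • coordForm 2 2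

lemma metricForm_apply (h d : ℝ) (v w : Coord) :
    metricForm h d v w = v 0 * w 0 + h * (v 0 * w 2 + v 2 * w 0) - v 1 * w 1
      + (h ^ 2 - d ^ 2) * (v 2 * w 2) - v 3 * w 3 - v 4 * w 4 := by
  simp [metricForm]
  ring

lemma metricForm_symm (h d : ℝ) (v w : Coord) : metricForm h d v w = metricForm h d w v := by
  simp only [metricForm_apply]
  ring

lemma metricForm_nondegenerate {h d : ℝ} (hd : d ≠ 0) (v : Coord)
    (hv : ∀ w, metricForm h d v w = 0) : v = 0 := by
  have h0 := hv (Pi.single 0 1)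
  have h1 := hv (Pi.single 1 1)
  have h2 := hv (Pi.single 2 1)
  have h3 := hv (Pi.single 3 1)
  have h4 := hv (Pi.single 4 1)
  simp [metricForm_apply] at h0 h1 h2 h3 h4
  have hv2 : v 2 = 0 := by
    -- The (t, y) block of the metric has determinant -d².
    have : d ^ 2 * v 2 = 0 := by linear_combination h * h0 - h2
    simpa [hd] using this
  ext i
  fin_cases i
  · simpa [hv2] using h0
  · exact h1
  · exact hv2
  · exact h3
  · exact h4

/-- The Christoffel symbols `(Γᵗ_{tx}, Γᵗ_{xy}, Γˣ_{ty}, Γˣ_{yy}, Γʸ_{tx}, Γʸ_{xy})` assembled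
into a bilinear map. -/
noncomputable def christoffelForm (a b c d e f : ℝ) : Coord →L[ℝ] Coord →L[ℝ] Coord :=
  -- `symmForm 2 2 1` counts the diagonal entry twice, hence the factor d / 2.
  a • symmForm 0 1 0 + b • symmForm 1 2 0 + c • symmForm 0 2 1 + (d / 2) • symmForm 2 2 1
    + e • symmForm 0 1 2 + f • symmForm 1 2 2

lemma christoffelForm_apply (a b c d e f : ℝ) (v w : Coord) :
    christoffelForm a b c d e f v w =
      ![a * (v 0 * w 1 + v 1 * w 0) + b * (v 1 * w 2 + v 2 * w 1),
        c * (v 0 * w 2 + v 2 * w 0) + d * (v 2 * w 2),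
        e * (v 0 * w 1 + v 1 * w 0) + f * (v 1 * w 2 + v 2 * w 1), 0, 0] := by
  ext i
  fin_cases i <;> simp [christoffelForm]
  ring

lemma hasDerivAt_smul_fixed {F : Type*} [NormedAddCommGroup F] [NormedSpace ℝ F] {f : ℝ → ℝ}
    {f' x : ℝ} (hf : HasDerivAt f f' x) (y : F) : HasDerivAt (fun x => f x • y) (f' • y) x :=
  hf.smul_const y

lemma hasDerivAt_linearCombination {F : Type*} [NormedAddCommGroup F] [NormedSpace ℝ F]
    {a b c d e f : ℝ → ℝ} {a' b' c' d' e' f' x : ℝ}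
    (ha : HasDerivAt a a' x) (hb : HasDerivAt b b' x) (hc : HasDerivAt c c' x)
    (hd : HasDerivAt d d' x) (he : HasDerivAt e e' x) (hf : HasDerivAt f f' x)
    (y₁ y₂ y₃ y₄ y₅ y₆ : F) :
    HasDerivAt (fun x => a x • y₁ + b x • y₂ + c x • y₃ + d x • y₄ + e x • y₅ + f x • y₆)
      (a' • y₁ + b' • y₂ + c' • y₃ + d' • y₄ + e' • y₅ + f' • y₆) x :=
  (((((ha.smul_const _).fun_add (hb.smul_const _)).fun_add (hc.smul_const _)).fun_add
    (hd.smul_const _)).fun_add (he.smul_const _)).fun_add (hf.smul_const _)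

lemma hasDerivAt_christoffelForm {a b c d e f : ℝ → ℝ} {a' b' c' d' e' f' x : ℝ}
    (ha : HasDerivAt a a' x) (hb : HasDerivAt b b' x) (hc : HasDerivAt c c' x)
    (hd : HasDerivAt d d' x) (he : HasDerivAt e e' x) (hf : HasDerivAt f f' x) :
    HasDerivAt (fun x => christoffelForm (a x) (b x) (c x) (d x) (e x) (f x))
      (christoffelForm a' b' c' d' e' f') x := by
  simp only [christoffelForm]
  exact hasDerivAt_linearCombination (F := Coord →L[ℝ] Coord →L[ℝ] Coord) ha hb hc
    (hd.div_const 2) he hf (symmForm 0 1 0) (symmForm 1 2 0) (symmForm 0 2 1) (symmForm 2 2 1)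
    (symmForm 0 1 2) (symmForm 1 2 2)

/-- The Christoffel symbols of the Gödel-type metric, in terms of the values of `H`, `D` and of
their derivatives. -/
noncomputable def christoffel (h d h₁ d₁ : ℝ) : Coord →L[ℝ] Coord →L[ℝ] Coord :=
  christoffelForm (h * h₁ / (2 * d ^ 2)) ((d ^ 2 + h ^ 2) * h₁ / (2 * d ^ 2) - h * d₁ / d)
    (h₁ / 2) (h * h₁ - d * d₁) (-h₁ / (2 * d ^ 2)) (d₁ / d - h * h₁ / (2 * d ^ 2))

/-- The derivative of `christoffel` along a curve of parameters. -/
noncomputable def christoffelDeriv (h d h₁ d₁ h₂ d₂ : ℝ) : Coord →L[ℝ] Coord →L[ℝ] Coord :=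
  christoffelForm
    ((h₁ * h₁ + h * h₂) / (2 * d ^ 2) - h * h₁ * d₁ / d ^ 3)
    (((2 * d * d₁ + 2 * h * h₁) * h₁ + (d ^ 2 + h ^ 2) * h₂) / (2 * d ^ 2)
      - (d ^ 2 + h ^ 2) * h₁ * d₁ / d ^ 3 - ((h₁ * d₁ + h * d₂) / d - h * d₁ * d₁ / d ^ 2))
    (h₂ / 2) (h₁ * h₁ + h * h₂ - (d₁ * d₁ + d * d₂))
    (-h₂ / (2 * d ^ 2) + h₁ * d₁ / d ^ 3)
    (d₂ / d - d₁ * d₁ / d ^ 2 - ((h₁ * h₁ + h * h₂) / (2 * d ^ 2) - h * h₁ * d₁ / d ^ 3))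

lemma hasDerivAt_christoffel {H D H₁ D₁ : ℝ → ℝ} {h₂ d₂ x : ℝ} (hH : HasDerivAt H (H₁ x) x)
    (hD : HasDerivAt D (D₁ x) x) (hH₁ : HasDerivAt H₁ h₂ x) (hD₁ : HasDerivAt D₁ d₂ x)
    (hx : D x ≠ 0) :
    HasDerivAt (fun x => christoffel (H x) (D x) (H₁ x) (D₁ x))
      (christoffelDeriv (H x) (D x) (H₁ x) (D₁ x) h₂ d₂) x := by
  have h2 : (2 : ℝ) * D x ^ 2 ≠ 0 := by positivity
  have hD2 : HasDerivAt (fun x => 2 * D x ^ 2) (4 * D x * D₁ x) x :=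
    ((hD.fun_pow 2).const_mul 2).congr_deriv (by push_cast; ring)
  apply hasDerivAt_christoffelForm
  · refine HasDerivAt.congr_deriv ((hH.fun_mul hH₁).fun_div hD2 h2) ?_
    field_simp
    ring
  · refine HasDerivAt.congr_deriv
      (((((hD.fun_pow 2).fun_add (hH.fun_pow 2)).fun_mul hH₁).fun_div hD2 h2).fun_sub
        ((hH.fun_mul hD₁).fun_div hD hx)) ?_
    push_cast
    field_simp
    ring
  · exact hH₁.div_const 2
  · exact (hH.fun_mul hH₁).fun_sub (hD.fun_mul hD₁)
  · refine HasDerivAt.congr_deriv (hH₁.fun_neg.fun_div hD2 h2) ?_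
    field_simp
    ring
  · refine HasDerivAt.congr_deriv ((hD₁.fun_div hD hx).fun_sub ((hH.fun_mul hH₁).fun_div hD2 h2)) ?_
    field_simp
    ring

lemma hasFDerivAt_comp_x {F : Type*} [NormedAddCommGroup F] [NormedSpace ℝ F] {f : ℝ → F} {f' : F}
    {p : Coord} (hf : HasDerivAt f f' (p 1)) :
    HasFDerivAt (fun q : Coord => f (q 1))
      ((ContinuousLinearMap.proj 1 : Coord →L[ℝ] ℝ).smulRight f') p := by
  have h : HasFDerivAt (fun q : Coord => f (q 1)) ((ContinuousLinearMap.toSpanSingleton ℝ f').comp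
      (ContinuousLinearMap.proj 1 : Coord →L[ℝ] ℝ)) p :=
    HasFDerivAt.comp p (g := f) (f := fun q : Coord => q 1) hf.hasFDerivAt
      (ContinuousLinearMap.proj 1 : Coord →L[ℝ] ℝ).hasFDerivAt
  exact h.congr_fderiv (by ext; rfl)

lemma hasDerivAt_metricForm {H D : ℝ → ℝ} {h₁ d₁ x : ℝ} (hH : HasDerivAt H h₁ x)
    (hD : HasDerivAt D d₁ x) :
    HasDerivAt (fun x => metricForm (H x) (D x)) (h₁ • (coordForm 0 2 + coordForm 2 0)
      + (2 * H x * h₁ - 2 * D x * d₁) • coordForm 2 2) x := by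
  have := ((hasDerivAt_smul_fixed hH (coordForm 0 2 + coordForm 2 0)).const_add
    (coordForm 0 0 - coordForm 1 1 - coordForm 3 3 - coordForm 4 4)).fun_add
    (hasDerivAt_smul_fixed ((hH.fun_pow 2).fun_sub (hD.fun_pow 2)) (coordForm 2 2))
  simpa [metricForm] using this

lemma fderiv_metricForm {H D : ℝ → ℝ} {h₁ d₁ : ℝ} {p : Coord} (hH : HasDerivAt H h₁ (p 1))
    (hD : HasDerivAt D d₁ (p 1)) (z v w : Coord) :
    fderiv ℝ (fun p : Coord => metricForm (H (p 1)) (D (p 1))) p z v w =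
      z 1 * (h₁ * (v 0 * w 2 + v 2 * w 0)
        + (2 * H (p 1) * h₁ - 2 * D (p 1) * d₁) * (v 2 * w 2)) := by
  have h : HasFDerivAt (fun p : Coord => metricForm (H (p 1)) (D (p 1))) _ p :=
    hasFDerivAt_comp_x (f := fun x => metricForm (H x) (D x)) (hasDerivAt_metricForm hH hD)
  rw [h.fderiv]
  rfl

lemma isLeviCivita_christoffel {Ω : Set Coord} {H D H₁ D₁ : ℝ → ℝ}
    (hH : ∀ x ∈ xRange Ω, HasDerivAt H (H₁ x) x) (hD : ∀ x ∈ xRange Ω, HasDerivAt D (D₁ x) x)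
    (hD0 : ∀ x ∈ xRange Ω, D x ≠ 0) :
    IsLeviCivita (fun p : Coord => metricForm (H (p 1)) (D (p 1)))
      (fun p => christoffel (H (p 1)) (D (p 1)) (H₁ (p 1)) (D₁ (p 1))) Ω where
  torsion_free p hp v w := by
    simp only [christoffel, christoffelForm_apply]
    congr 1
    · ring
    · congr 1
      · ring
      · congr 1
        ring
  differentiableAt p hp := (hasFDerivAt_comp_x (f := fun x => metricForm (H x) (D x)) (hasDerivAt_metricForm
    (hH _ ⟨p, hp, rfl⟩) (hD _ ⟨p, hp, rfl⟩))).differentiableAt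
  compatible p hp z v w := by
    have h0 := hD0 _ ⟨p, hp, rfl⟩
    rw [fderiv_metricForm (hH _ ⟨p, hp, rfl⟩) (hD _ ⟨p, hp, rfl⟩)]
    simp only [christoffel, christoffelForm_apply, metricForm_apply]
    generalize H (p 1) = h, D (p 1) = d, H₁ (p 1) = h₁, D₁ (p 1) = d₁ at h0 ⊢
    simp
    field_simp
    ring

/-- The components of the Ricci tensor of the Gödel-type metric. -/
noncomputable def ricciMatrix (h d h₁ d₁ h₂ d₂ : ℝ) : Matrix (Fin 5) (Fin 5) ℝ :=
  -- In the coframe θ⁰ = dt + H dy, θ¹ = dx, θ² = D dy the tensor is a θ⁰θ⁰ + r (θ⁰θ² + θ²θ⁰) + k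
  -- (θ¹θ¹ + θ²θ²), where r is half the x-derivative of H'/D.
  let a := (h₁ / d) ^ 2 / 2
  let r := (h₂ / d - h₁ * d₁ / d ^ 2) / 2
  let k := a - d₂ / d
  !![a, 0, a * h + r * d, 0, 0;
     0, k, 0, 0, 0;
     a * h + r * d, 0, a * h ^ 2 + k * d ^ 2 + 2 * r * h * d, 0, 0;
     0, 0, 0, 0, 0;
     0, 0, 0, 0, 0]

open Matrix in
lemma ricci_christoffel {Ω : Set Coord} {H D H₁ D₁ H₂ D₂ : ℝ → ℝ}
    (hH : ∀ x ∈ xRange Ω, HasDerivAt H (H₁ x) x) (hD : ∀ x ∈ xRange Ω, HasDerivAt D (D₁ x) x)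
    (hH₁ : ∀ x ∈ xRange Ω, HasDerivAt H₁ (H₂ x) x)
    (hD₁ : ∀ x ∈ xRange Ω, HasDerivAt D₁ (D₂ x) x)
    (hD0 : ∀ x ∈ xRange Ω, D x ≠ 0) {p : Coord} (hp : p ∈ Ω) (w z : Coord) :
    ricci (fun p : Coord => christoffel (H (p 1)) (D (p 1)) (H₁ (p 1)) (D₁ (p 1))) p w z
      = w ⬝ᵥ ricciMatrix (H (p 1)) (D (p 1)) (H₁ (p 1)) (D₁ (p 1)) (H₂ (p 1)) (D₂ (p 1)) *ᵥ z := by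
  have hx : p 1 ∈ xRange Ω := ⟨p, hp, rfl⟩
  have h0 := hD0 _ hx
  have hd : HasFDerivAt (fun p : Coord => christoffel (H (p 1)) (D (p 1)) (H₁ (p 1)) (D₁ (p 1)))
      _ p := hasFDerivAt_comp_x (f := fun x => christoffel (H x) (D x) (H₁ x) (D₁ x))
    (hasDerivAt_christoffel (hH _ hx) (hD _ hx) (hH₁ _ hx) (hD₁ _ hx) h0)
  rw [ricci, LinearMap.trace_eq_matrix_trace ℝ (Pi.basisFun ℝ (Fin 5)), Matrix.trace,
    Fin.sum_univ_five]
  simp only [Matrix.diag_apply, LinearMap.toMatrix_apply, Pi.basisFun_repr, Pi.basisFun_apply,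
    LinearMap.coe_mk, AddHom.coe_mk, curvature, hd.fderiv]
  simp only [ContinuousLinearMap.smulRight_apply, ContinuousLinearMap.proj_apply,
    christoffel, christoffelDeriv, christoffelForm_apply, _root_.smul_apply]
  generalize H (p 1) = h, D (p 1) = d, H₁ (p 1) = h₁, D₁ (p 1) = d₁, H₂ (p 1) = h₂,
    D₂ (p 1) = d₂ at h0 ⊢
  simp [ricciMatrix, dotProduct, Matrix.mulVec, Fin.sum_univ_five]
  field_simp
  ring



/-! ### Local homogeneity forces the two quotients to be constant. -/

lemma isOpen_xRange {Ω : Set Coord} (hΩ : IsOpen Ω) : IsOpen (xRange Ω) :=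
  isOpenMap_eval (1 : Fin 5) Ω hΩ

lemma isConnected_xRange {Ω : Set Coord} (hΩ : IsConnected Ω) : IsConnected (xRange Ω) :=
  hΩ.image _ (continuous_apply (1 : Fin 5)).continuousOn

/-- A continuous nowhere zero D keeps its sign near each point, so it coincides there with √F or
-√F. -/
lemma contDiffOn_of_sq {I : Set ℝ} (hI : IsOpen I) {D F : ℝ → ℝ} (hF : ContDiffOn ℝ ∞ F I)
    (hpos : ∀ x ∈ I, 0 < F x) (hD : ContinuousOn D I) (hD2 : ∀ x ∈ I, D x ^ 2 = F x) :
    ContDiffOn ℝ ∞ D I := by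
  intro x hx
  apply ContDiffAt.contDiffWithinAt
  have hIx := hI.mem_nhds hx
  have hsqrt := (hF.contDiffAt hIx).sqrt (hpos x hx).ne'
  have hcont := hD.continuousAt hIx
  have hne : D x ≠ 0 := fun h => by
    have := hpos x hx
    rw [← hD2 x hx, h] at this
    simp at this
  rcases hne.lt_or_gt with h | h
  · refine hsqrt.neg.congr_of_eventuallyEq ?_
    filter_upwards [hIx, hcont.eventually_lt_const h] with y hy hy0
    rw [← hD2 y hy, Real.sqrt_sq_eq_abs, abs_of_neg hy0, neg_neg]
  · refine hsqrt.congr_of_eventuallyEq ?_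
    filter_upwards [hIx, hcont.eventually_const_lt h] with y hy hy0
    rw [← hD2 y hy, Real.sqrt_sq_eq_abs, abs_of_pos hy0]

lemma hasDerivAt_of_contDiffOn {I : Set ℝ} (hI : IsOpen I) {f : ℝ → ℝ}
    (hf : ContDiffOn ℝ ∞ f I) {x : ℝ} (hx : x ∈ I) : HasDerivAt f (deriv f x) x :=
  ((hf.contDiffAt (hI.mem_nhds hx)).differentiableAt (by simp)).hasDerivAt

lemma contDiffOn_deriv {I : Set ℝ} (hI : IsOpen I) {f : ℝ → ℝ} (hf : ContDiffOn ℝ ∞ f I) :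
    ContDiffOn ℝ ∞ (deriv f) I :=
  ((contDiffOn_infty_iff_deriv_of_isOpen hI).1 hf).2

lemma metric_eq_metricForm {H G D : ℝ → ℝ} {p : Coord}
    (h : D (p 1) ^ 2 = G (p 1) + H (p 1) ^ 2) (v w : Coord) :
    metric H G p v w = metricForm (H (p 1)) (D (p 1)) v w := by
  rw [metric_apply, metricForm_apply]
  linear_combination (v 2 * w 2) * h

lemma IsIsometryIn.isLocalIsometryOn {Ω : Set Coord} {H G D : ℝ → ℝ}
    {Φ : OpenPartialHomeomorph Coord Coord} (hΦ : IsIsometryIn (metric H G) Ω Φ)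
    (hD2 : ∀ x ∈ xRange Ω, D x ^ 2 = G x + H x ^ 2) :
    IsLocalIsometryOn (fun p : Coord => metricForm (H (p 1)) (D (p 1))) Ω Φ.source Φ where
  isOpen := Φ.open_source
  subset := hΦ.source_subset
  mapsTo := fun _ hp => hΦ.target_subset (Φ.map_source hp)
  contDiffOn := hΦ.contDiffOn
  map_metric p hp v w := by
    rw [← metric_eq_metricForm (hD2 _ ⟨p, hΦ.source_subset hp, rfl⟩),
      ← metric_eq_metricForm (hD2 _ ⟨Φ p, hΦ.target_subset (Φ.map_source hp), rfl⟩)]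
    exact hΦ.map_metric p hp v w

/-- The Ricci tensor of the Gödel-type metric with its first index raised. -/
noncomputable def ricciOperator (h d h₁ d₁ h₂ d₂ : ℝ) : Matrix (Fin 5) (Fin 5) ℝ :=
  let a := (h₁ / d) ^ 2 / 2
  let r := (h₂ / d - h₁ * d₁ / d ^ 2) / 2
  let k := a - d₂ / d
  !![a + r * h / d, 0, a * h + r * d + h * (k * d + r * h) / d, 0, 0;
     0, -k, 0, 0, 0;
     -r / d, 0, -(k * d + r * h) / d, 0, 0;
     0, 0, 0, 0, 0;
     0, 0, 0, 0, 0]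

open Matrix in
lemma metricForm_ricciOperator {h d : ℝ} (hd : d ≠ 0) (h₁ d₁ h₂ d₂ : ℝ) (v w : Coord) :
    metricForm h d v (ricciOperator h d h₁ d₁ h₂ d₂ *ᵥ w) =
      v ⬝ᵥ ricciMatrix h d h₁ d₁ h₂ d₂ *ᵥ w := by
  rw [metricForm_apply]
  simp only [ricciOperator, ricciMatrix]
  generalize (h₁ / d) ^ 2 / 2 = a, (h₂ / d - h₁ * d₁ / d ^ 2) / 2 = r
  generalize a - d₂ / d = k
  simp [dotProduct, Matrix.mulVec, Fin.sum_univ_five]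
  field_simp
  ring

lemma trace_ricciOperator {h d : ℝ} (hd : d ≠ 0) (h₁ d₁ h₂ d₂ : ℝ) :
    (ricciOperator h d h₁ d₁ h₂ d₂).trace = 2 * (d₂ / d) - (h₁ / d) ^ 2 / 2 := by
  simp [ricciOperator, Matrix.trace, Fin.sum_univ_five]
  field_simp
  ring

/-- The x-direction splits off: the only nonzero entry in the x-row of the operator is this diagonal
one. -/
lemma isRoot_charpoly_ricciOperator (h d h₁ d₁ h₂ d₂ : ℝ) :
    (ricciOperator h d h₁ d₁ h₂ d₂).charpoly.IsRoot (d₂ / d - (h₁ / d) ^ 2 / 2) := by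
  rw [Polynomial.IsRoot, Matrix.eval_charpoly]
  apply Matrix.det_eq_zero_of_row_eq_zero (1 : Fin 5)
  intro j
  fin_cases j <;> simp [ricciOperator]

open Matrix in
/-- The endomorphisms obtained by raising an index of equivalent bilinear forms with equivalent
nondegenerate forms are conjugate, hence have the same characteristic polynomial. -/
lemma charpoly_eq_of_form_eq {n : Type*} [Fintype n] [DecidableEq n]
    {g g' R R' : (n → ℝ) → (n → ℝ) → ℝ} {A A' : Matrix n n ℝ}
    {L : (n → ℝ) →ₗ[ℝ] (n → ℝ)} (hL : Function.Bijective L)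
    (hnd : ∀ v w, (∀ u, g' u v = g' u w) → v = w)
    (hA : ∀ v w, g v (A *ᵥ w) = R v w) (hA' : ∀ v w, g' v (A' *ᵥ w) = R' v w)
    (hg : ∀ v w, g' (L v) (L w) = g v w) (hR : ∀ v w, R' (L v) (L w) = R v w) :
    A'.charpoly = A.charpoly := by
  let e : (n → ℝ) ≃ₗ[ℝ] (n → ℝ) := LinearEquiv.ofBijective L hL
  have h : toLin' A' = e.conj (toLin' A) := by
    refine LinearMap.ext fun v => ?_
    obtain ⟨v, rfl⟩ := e.surjective v
    rw [LinearEquiv.conj_apply_apply, LinearEquiv.symm_apply_apply]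
    refine hnd _ _ fun u => ?_
    obtain ⟨u, rfl⟩ := e.surjective u
    rw [toLin'_apply, toLin'_apply, hA']
    exact (hR u v).trans ((hA u v).symm.trans (hg u _).symm)
  rw [← charpoly_toLin' A', h, LinearEquiv.charpoly_conj, charpoly_toLin']

lemma eq_of_continuousOn_of_finite {S T : Set ℝ} (hS : IsPreconnected S) (hT : T.Finite)
    {f : ℝ → ℝ} (hf : ContinuousOn f S) (hfT : Set.MapsTo f S T) {x y : ℝ} (hx : x ∈ S)
    (hy : y ∈ S) : f x = f y :=
  hS.constant_of_mapsTo hT.isDiscrete hf hfT hx hy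

theorem constants_of_locallyHomogeneous {Ω : Set Coord} (hΩ : IsOpen Ω) (hΩc : IsConnected Ω)
    {H G D : ℝ → ℝ} (hH : ContDiffOn ℝ ∞ H (xRange Ω)) (hD : ContDiffOn ℝ ∞ D (xRange Ω))
    (hD0 : ∀ x ∈ xRange Ω, D x ≠ 0) (hD2 : ∀ x ∈ xRange Ω, D x ^ 2 = G x + H x ^ 2)
    (hom : LocallyHomogeneous (metric H G) Ω) {x y : ℝ} (hx : x ∈ xRange Ω)
    (hy : y ∈ xRange Ω) :
    deriv H x / D x = deriv H y / D y ∧ deriv (deriv D) x / D x = deriv (deriv D) y / D y := by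
  have hI := isOpen_xRange hΩ
  have hIc := (isConnected_xRange hΩc).isPreconnected
  have hH₁ := contDiffOn_deriv hI hH
  have hD₁ := contDiffOn_deriv hI hD
  have dH := fun x hx => hasDerivAt_of_contDiffOn hI hH (x := x) hx
  have dD := fun x hx => hasDerivAt_of_contDiffOn hI hD (x := x) hx
  have dH₁ := fun x hx => hasDerivAt_of_contDiffOn hI hH₁ (x := x) hx
  have dD₁ := fun x hx => hasDerivAt_of_contDiffOn hI hD₁ (x := x) hx
  have hΓ := isLeviCivita_christoffel dH dD hD0
  set A : ℝ → Matrix (Fin 5) (Fin 5) ℝ := fun x => ricciOperator (H x) (D x) (deriv H x)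
    (deriv D x) (deriv (deriv H) x) (deriv (deriv D) x) with hA
  have hchar : ∀ x ∈ xRange Ω, ∀ y ∈ xRange Ω, (A x).charpoly = (A y).charpoly := by
    rintro _ ⟨q, hq, rfl⟩ _ ⟨p, hp, rfl⟩
    obtain ⟨Φ, hΦ, hpΦ, rfl⟩ := hom p hp q hq
    have hloc := hΦ.isLocalIsometryOn hD2
    have hnd : ∀ p ∈ Ω, ∀ v, (∀ w, metricForm (H (p 1)) (D (p 1)) v w = 0) → v = 0 :=
      fun p hp => metricForm_nondegenerate (hD0 _ ⟨p, hp, rfl⟩)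
    refine charpoly_eq_of_form_eq (L := (fderiv ℝ Φ p : Coord →ₗ[ℝ] Coord))
      ⟨hloc.fderiv_injective hnd hpΦ, hloc.fderiv_surjective hnd hpΦ⟩
      (g := fun v w => metricForm (H (p 1)) (D (p 1)) v w)
      (g' := fun v w => metricForm (H (Φ p 1)) (D (Φ p 1)) v w) ?_
      (metricForm_ricciOperator (hD0 _ ⟨p, hp, rfl⟩) _ _ _ _)
      (metricForm_ricciOperator (hD0 _ ⟨Φ p, hq, rfl⟩) _ _ _ _)
      (hloc.map_metric p hpΦ) ?_
    · intro v w h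
      refine sub_eq_zero.1 (hnd _ hq _ fun u => ?_)
      rw [metricForm_symm, map_sub, h u, sub_self]
    · intro v w
      rw [← ricci_christoffel dH dD dH₁ dD₁ hD0 hq, ← ricci_christoffel dH dD dH₁ dD₁ hD0 hp]
      refine hloc.ricci_map hΓ (fun _ _ => metricForm_symm _ _) hnd (fun r hr => ?_) hpΦ v w
      have hr' : r 1 ∈ xRange Ω := ⟨r, hr, rfl⟩
      exact (hasFDerivAt_comp_x (f := fun x => christoffel (H x) (D x) (deriv H x) (deriv D x))
        (hasDerivAt_christoffel (dH _ hr') (dD _ hr') (dH₁ _ hr') (dD₁ _ hr')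
          (hD0 _ hr'))).differentiableAt
  have hcf : ContinuousOn (fun x => deriv H x / D x) (xRange Ω) :=
    hH₁.continuousOn.div hD.continuousOn hD0
  have hck : ContinuousOn (fun x => deriv (deriv D) x / D x) (xRange Ω) :=
    (contDiffOn_deriv hI hD₁).continuousOn.div hD.continuousOn hD0
  -- Equal characteristic polynomials alone do not match the x-eigenvalues at two points, which
  -- might be different roots; continuity on the connected range excludes this.
  have hroot : ∀ x ∈ xRange Ω, ∀ y ∈ xRange Ω,
      deriv (deriv D) x / D x - (deriv H x / D x) ^ 2 / 2 =
        deriv (deriv D) y / D y - (deriv H y / D y) ^ 2 / 2 := by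
    intro x hx y hy
    refine eq_of_continuousOn_of_finite hIc (T := {t | (A y).charpoly.IsRoot t})
      (f := fun x => deriv (deriv D) x / D x - (deriv H x / D x) ^ 2 / 2)
      (Polynomial.finite_setOfPred_isRoot (Matrix.charpoly_monic _).ne_zero)
      (hck.sub ((hcf.pow 2).div_const 2)) (fun z hz => ?_) hx hy
    rw [Set.mem_ofPred_eq, ← hchar z hz y hy]
    exact isRoot_charpoly_ricciOperator _ _ _ _ _ _
  have htrace : ∀ x ∈ xRange Ω, ∀ y ∈ xRange Ω,
      2 * (deriv (deriv D) x / D x) - (deriv H x / D x) ^ 2 / 2 =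
        2 * (deriv (deriv D) y / D y) - (deriv H y / D y) ^ 2 / 2 := by
    intro x hx y hy
    rw [← trace_ricciOperator (h := H x) (hD0 x hx) _ (deriv D x) (deriv (deriv H) x),
      ← trace_ricciOperator (h := H y) (hD0 y hy) _ (deriv D y) (deriv (deriv H) y)]
    change (A x).trace = (A y).trace
    rw [Matrix.trace_eq_neg_charpoly_coeff, Matrix.trace_eq_neg_charpoly_coeff, hchar x hx y hy]
  -- Trace minus eigenvalue is D''/D; the square of H'/D then follows.
  refine ⟨?_, by linarith [hroot x hx y hy, htrace x hx y hy]⟩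
  refine eq_of_continuousOn_of_finite hIc (f := fun x => deriv H x / D x)
    (T := {deriv H y / D y, -(deriv H y / D y)}) (Set.toFinite _) hcf (fun z hz => ?_) hx hy
  have : (deriv H z / D z) ^ 2 = (deriv H y / D y) ^ 2 := by
    linarith [hroot z hz y hy, htrace z hz y hy]
  exact sq_eq_sq_iff_eq_or_eq_neg.1 this



/-! ### From charts into a common model to local isometries. -/

/-- A smooth map with everywhere injective differential restricts, near any given point, to a
diffeomorphism between open sets. -/
lemma exists_openPartialHomeomorph {E : Type*} [NormedAddCommGroup E] [NormedSpace ℝ E]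
    [FiniteDimensional ℝ E] {Ψ : E → E} {U : Set E} (hU : IsOpen U) (hΨ : ContDiffOn ℝ ∞ Ψ U)
    (hinj : ∀ r ∈ U, Function.Injective (fderiv ℝ Ψ r)) {p : E} (hp : p ∈ U) :
    ∃ e : OpenPartialHomeomorph E E, p ∈ e.source ∧ e.source ⊆ U ∧ (∀ r, e r = Ψ r) ∧
      ContDiffOn ℝ ∞ e.symm e.target := by
  have hat : ∀ r ∈ U, ContDiffAt ℝ ∞ Ψ r := fun r hr => hΨ.contDiffAt (hU.mem_nhds hr)
  have heq : ∀ r ∈ U, ∃ L : E ≃L[ℝ] E, HasFDerivAt Ψ (L : E →L[ℝ] E) r := fun r hr =>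
    ⟨(LinearEquiv.ofInjectiveEndo (fderiv ℝ Ψ r : E →ₗ[ℝ] E)
      (hinj r hr)).toContinuousLinearEquiv, by
        have := ((hat r hr).differentiableAt (by simp)).hasFDerivAt
        exact this.congr_fderiv (by ext; rfl)⟩
  obtain ⟨L, hL⟩ := heq p hp
  let e₀ := (hat p hp).toOpenPartialHomeomorph Ψ hL (by simp)
  refine ⟨e₀.restrOpen U hU, ?_, ?_, fun r => rfl, ?_⟩
  · rw [OpenPartialHomeomorph.restrOpen_source]
    exact ⟨(hat p hp).mem_toOpenPartialHomeomorph_source hL (by simp), hp⟩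
  · rw [OpenPartialHomeomorph.restrOpen_source]
    exact Set.inter_subset_right
  · intro a ha
    have hs := (e₀.restrOpen U hU).map_target ha
    rw [OpenPartialHomeomorph.restrOpen_source] at hs
    obtain ⟨K, hK⟩ := heq _ hs.2
    exact ((e₀.restrOpen U hU).contDiffAt_symm ha hK (hat _ hs.2)).contDiffWithinAt

/-- If every point of `Ω` has a chart sending it to the origin and in which the metric takes one
and the same form `M`, then `Ω` is locally homogeneous. -/
lemma locallyHomogeneous_of_charts {Ω : Set Coord} {g : MetricField}
    (hnd : ∀ p ∈ Ω, ∀ v, (∀ w, g p v w = 0) → v = 0) (M : Coord → Coord → Coord → ℝ)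
    (hM : ∀ r w, M r 0 w = 0)
    (hchart : ∀ p ∈ Ω, ∃ (Ψ : Coord → Coord) (U : Set Coord), IsOpen U ∧ p ∈ U ∧ U ⊆ Ω ∧
      ContDiffOn ℝ ∞ Ψ U ∧ Ψ p = 0 ∧
      ∀ r ∈ U, ∀ v w, M (Ψ r) (fderiv ℝ Ψ r v) (fderiv ℝ Ψ r w) = g r v w) :
    LocallyHomogeneous g Ω := by
  have hloc : ∀ p ∈ Ω, ∃ e : OpenPartialHomeomorph Coord Coord, p ∈ e.source ∧ e.source ⊆ Ω ∧
      ContDiffOn ℝ ∞ e e.source ∧ ContDiffOn ℝ ∞ e.symm e.target ∧ e p = 0 ∧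
      ∀ r ∈ e.source, ∀ v w, M (e r) (fderiv ℝ e r v) (fderiv ℝ e r w) = g r v w := by
    intro p hp
    obtain ⟨Ψ, U, hU, hpU, hUΩ, hΨ, hΨp, hmet⟩ := hchart p hp
    obtain ⟨e, hpe, heU, heΨ, hes⟩ := exists_openPartialHomeomorph hU hΨ (fun r hr => by
      rw [injective_iff_map_eq_zero]
      intro v hv
      refine hnd r (hUΩ hr) v fun w => ?_
      rw [← hmet r hr, hv, hM]) hpU
    obtain rfl : (e : Coord → Coord) = Ψ := funext heΨ
    exact ⟨e, hpe, heU.trans hUΩ, hΨ.mono heU, hes, hΨp, fun r hr => hmet r (heU hr)⟩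
  intro p hp q hq
  obtain ⟨e, hpe, heΩ, hes, het, hep, hem⟩ := hloc p hp
  obtain ⟨f, hqf, hfΩ, hfs, hft, hfq, hfm⟩ := hloc q hq
  -- Both charts hit the origin, so f⁻¹ ∘ e is defined at p and sends it to q.
  have h0 : (0 : Coord) ∈ f.target := hfq ▸ f.map_source hqf
  have hsub : ∀ r ∈ (e.trans f.symm).source, r ∈ e.source ∧ e r ∈ f.target := fun r hr => by
    simpa using hr
  have hsub' : ∀ r ∈ (e.trans f.symm).target, r ∈ f.source ∧ f r ∈ e.target := fun r hr => by
    simpa using hr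
  refine ⟨e.trans f.symm, ⟨fun r hr => heΩ (hsub r hr).1, fun r hr => hfΩ (hsub' r hr).1, ?_, ?_,
    ?_⟩, by simp [hpe, hep, h0], by simp [hep, ← hfq, hqf]⟩
  · exact hft.comp (hes.mono fun r hr => (hsub r hr).1) fun r hr => (hsub r hr).2
  · exact het.comp (hfs.mono fun r hr => (hsub' r hr).1) fun r hr => (hsub' r hr).2
  · intro r hr v w
    obtain ⟨hr1, hr2⟩ := hsub r hr
    have hde : DifferentiableAt ℝ e r :=
      (hes.contDiffAt (e.open_source.mem_nhds hr1)).differentiableAt (by simp)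
    have hdf : DifferentiableAt ℝ f (f.symm (e r)) :=
      (hfs.contDiffAt (f.open_source.mem_nhds (f.map_target hr2))).differentiableAt (by simp)
    have hdfs : DifferentiableAt ℝ f.symm (e r) :=
      (hft.contDiffAt (f.open_target.mem_nhds hr2)).differentiableAt (by simp)
    have hΦ : DifferentiableAt ℝ (e.trans f.symm) r := hdfs.comp r hde
    have hev : (fun s => f ((e.trans f.symm) s)) =ᶠ[nhds r] e := by
      filter_upwards [(e.trans f.symm).open_source.mem_nhds hr] with s hs
      exact f.right_inv (hsub s hs).2
    have hchain : ∀ v, fderiv ℝ f (f.symm (e r)) (fderiv ℝ (e.trans f.symm) r v)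
        = fderiv ℝ e r v := by
      intro v
      have h1 := (HasFDerivAt.comp (f := e.trans f.symm) (g := f) r hdf.hasFDerivAt
        hΦ.hasFDerivAt).congr_of_eventuallyEq hev.symm
      exact congrArg (fun L => L v) (h1.unique hde.hasFDerivAt)
    have h1 := hfm _ (f.map_target hr2) (fderiv ℝ (e.trans f.symm) r v)
      (fderiv ℝ (e.trans f.symm) r w)
    rw [hchain, hchain, f.right_inv hr2, hem r hr1] at h1
    exact h1.symm

/-! ### Fundamental solutions of the linear equations and their conserved quantities. -/

/-- The solutions of `f'' = k f` with initial values `(1, 0)` and `(0, 1)`. -/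
lemma exists_cosh_sinh_like (k : ℝ) : ∃ C S : ℝ → ℝ, ContDiff ℝ ∞ C ∧ ContDiff ℝ ∞ S ∧
    (∀ x, HasDerivAt C (k * S x) x) ∧ (∀ x, HasDerivAt S (C x) x) ∧ C 0 = 1 ∧ S 0 = 0 := by
  rcases lt_trichotomy k 0 with hk | rfl | hk
  · have hs : √(-k) ≠ 0 := (Real.sqrt_pos.2 (by linarith)).ne'
    have hs2 : √(-k) ^ 2 = -k := Real.sq_sqrt (by linarith)
    have hl : ∀ x : ℝ, HasDerivAt (fun x => √(-k) * x) (√(-k)) x := fun x => by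
      simpa using (hasDerivAt_id x).const_mul (√(-k))
    refine ⟨fun x => Real.cos (√(-k) * x), fun x => Real.sin (√(-k) * x) / √(-k), by fun_prop,
      by fun_prop, fun x => ?_, fun x => ?_, by simp, by simp⟩
    · refine (hl x).cos.congr_deriv ?_
      field_simp
      rw [hs2]
      ring
    · refine ((hl x).sin.div_const _).congr_deriv ?_
      field_simp
  · exact ⟨fun _ => 1, fun x => x, contDiff_const, contDiff_id,
      fun x => by simpa using hasDerivAt_const x (1 : ℝ), fun x => hasDerivAt_id x, rfl, rfl⟩
  · have hs : √k ≠ 0 := (Real.sqrt_pos.2 hk).ne'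
    have hs2 : √k ^ 2 = k := Real.sq_sqrt hk.le
    have hl : ∀ x : ℝ, HasDerivAt (fun x => √k * x) (√k) x := fun x => by
      simpa using (hasDerivAt_id x).const_mul (√k)
    refine ⟨fun x => Real.cosh (√k * x), fun x => Real.sinh (√k * x) / √k, by fun_prop,
      by fun_prop, fun x => ?_, fun x => ?_, by simp, by simp⟩
    · refine (hl x).cosh.congr_deriv ?_
      field_simp
      rw [hs2]
      ring
    · refine ((hl x).sinh.div_const _).congr_deriv ?_
      field_simp

/-- The solution of `κ'' = 1 - c κ` with vanishing initial values, and its derivative. -/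
lemma exists_versine_like (c : ℝ) : ∃ κ σ : ℝ → ℝ, ContDiff ℝ ∞ κ ∧ ContDiff ℝ ∞ σ ∧
    (∀ x, HasDerivAt κ (σ x) x) ∧ (∀ x, HasDerivAt σ (1 - c * κ x) x) ∧ κ 0 = 0 ∧ σ 0 = 0 := by
  rcases eq_or_ne c 0 with rfl | hc
  · refine ⟨fun x => x ^ 2 / 2, fun x => x, by fun_prop, by fun_prop, fun x => ?_, fun x => ?_,
      by simp, rfl⟩
    · refine ((hasDerivAt_pow 2 x).div_const 2).congr_deriv ?_
      simp
    · exact (hasDerivAt_id' x).congr_deriv (by simp)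
  · obtain ⟨C, S, hC, hS, dC, dS, hC0, hS0⟩ := exists_cosh_sinh_like (-c)
    refine ⟨fun x => (1 - C x) / c, S, by fun_prop, hS, fun x => ?_, fun x => ?_, by simp [hC0],
      hS0⟩
    · refine (((dC x).const_sub 1).div_const c).congr_deriv ?_
      field_simp
    · refine (dS x).congr_deriv ?_
      field_simp
      ring

lemma eq_of_hasDerivAt_zero {f : ℝ → ℝ} (hf : ∀ x, HasDerivAt f 0 x) (x y : ℝ) : f x = f y :=
  is_const_of_deriv_eq_zero (fun x => (hf x).differentiableAt) (fun x => (hf x).deriv) x y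

lemma cosh_sq_like {k : ℝ} {C S : ℝ → ℝ} (dC : ∀ x, HasDerivAt C (k * S x) x)
    (dS : ∀ x, HasDerivAt S (C x) x) (hC : C 0 = 1) (hS : S 0 = 0) (x : ℝ) :
    C x ^ 2 - k * S x ^ 2 = 1 := by
  have h := eq_of_hasDerivAt_zero (f := fun x => C x ^ 2 - k * S x ^ 2) (fun x => by
    refine (((dC x).fun_pow 2).fun_sub (((dS x).fun_pow 2).const_mul k)).congr_deriv ?_
    push_cast
    ring) x 0
  simpa [hC, hS] using h

lemma versine_sq_like {c : ℝ} {κ σ : ℝ → ℝ} (dκ : ∀ x, HasDerivAt κ (σ x) x)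
    (dσ : ∀ x, HasDerivAt σ (1 - c * κ x) x) (hκ : κ 0 = 0) (hσ : σ 0 = 0) (x : ℝ) :
    σ x ^ 2 = 2 * κ x - c * κ x ^ 2 := by
  have h := eq_of_hasDerivAt_zero (f := fun x => σ x ^ 2 - 2 * κ x + c * κ x ^ 2) (fun x => by
    refine ((((dσ x).fun_pow 2).fun_sub ((dκ x).const_mul 2)).fun_add
      (((dκ x).fun_pow 2).const_mul c)).congr_deriv ?_
    push_cast
    ring) x 0
  simp only [hκ, hσ] at h
  linarith

/-- Every solution of `D'' = k D` on an interval is the expected combination of the two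
fundamental solutions. -/
lemma eq_cosh_sinh_combination {I : Set ℝ} (hI : IsOpen I) (hIc : IsPreconnected I) {k : ℝ}
    {C S D D₁ : ℝ → ℝ} (dC : ∀ x, HasDerivAt C (k * S x) x) (dS : ∀ x, HasDerivAt S (C x) x)
    (hC : C 0 = 1) (hS : S 0 = 0) (dD : ∀ x ∈ I, HasDerivAt D (D₁ x) x)
    (dD₁ : ∀ x ∈ I, HasDerivAt D₁ (k * D x) x) {x₀ x : ℝ} (hx₀ : x₀ ∈ I) (hx : x ∈ I) :
    D x = D x₀ * C (x - x₀) + D₁ x₀ * S (x - x₀) := by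
  have dC' : ∀ x, HasDerivAt (fun x => C (x - x₀)) (k * S (x - x₀)) x := fun x =>
    (dC (x - x₀)).comp_sub_const x x₀
  have dS' : ∀ x, HasDerivAt (fun x => S (x - x₀)) (C (x - x₀)) x := fun x =>
    (dS (x - x₀)).comp_sub_const x x₀
  have const : ∀ f : ℝ → ℝ, (∀ y ∈ I, HasDerivAt f 0 y) → f x = f x₀ := fun f hf =>
    hI.is_const_of_deriv_eq_zero hIc
      (fun y hy => (hf y hy).differentiableAt.differentiableWithinAt)
      (fun y hy => (hf y hy).deriv) hx hx₀
  -- Two Wronskian-type conserved quantities, with values D x₀ and D₁ x₀ at x₀; solving them for D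
  -- uses C² - k S² = 1.
  have h1 := const (fun x => D x * C (x - x₀) - D₁ x * S (x - x₀)) fun y hy =>
    (((dD y hy).fun_mul (dC' y)).fun_sub ((dD₁ y hy).fun_mul (dS' y))).congr_deriv (by ring)
  have h2 := const (fun x => D₁ x * C (x - x₀) - k * (D x * S (x - x₀))) fun y hy =>
    (((dD₁ y hy).fun_mul (dC' y)).fun_sub
      (((dD y hy).fun_mul (dS' y)).const_mul k)).congr_deriv (by ring)
  simp only [sub_self, hC, hS] at h1 h2
  have h3 := cosh_sq_like dC dS hC hS (x - x₀)
  linear_combination -D x * h3 + C (x - x₀) * h1 + S (x - x₀) * h2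



/-! ### Calculus of functions of x and y, and primitives of closed one-forms. -/

/-- `f` depends on `x` and `y` to first order at `p`, with partial derivatives `α` and `β`. -/
def HasPartials (f : Coord → ℝ) (α β : ℝ) (p : Coord) : Prop :=
  HasFDerivAt f (α • (ContinuousLinearMap.proj 1 : Coord →L[ℝ] ℝ)
    + β • (ContinuousLinearMap.proj 2 : Coord →L[ℝ] ℝ)) p

namespace HasPartials

variable {f g : Coord → ℝ} {α β α' β' : ℝ} {p : Coord}

lemma congr (h : HasPartials f α β p) (hα : α = α') (hβ : β = β') : HasPartials f α' β' p := by
  rwa [← hα, ← hβ]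

lemma comp {u : ℝ → ℝ} {u' : ℝ} (hu : HasDerivAt u u' (f p)) (h : HasPartials f α β p) :
    HasPartials (fun q => u (f q)) (u' * α) (u' * β) p := by
  refine (hu.comp_hasFDerivAt p h).congr_fderiv ?_
  ext v
  simp
  ring

lemma of_x {u : ℝ → ℝ} {u' x₀ : ℝ} (hu : HasDerivAt u u' (p 1 - x₀)) :
    HasPartials (fun q => u (q 1 - x₀)) u' 0 p := by
  have h : HasPartials (fun q : Coord => q 1 - x₀) 1 0 p :=
    ((ContinuousLinearMap.proj 1 : Coord →L[ℝ] ℝ).hasFDerivAt.sub_const x₀).congr_fderiv (by simp)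
  exact (comp hu h).congr (by ring) (by ring)

lemma of_y {u : ℝ → ℝ} {u' y₀ : ℝ} (hu : HasDerivAt u u' (p 2 - y₀)) :
    HasPartials (fun q => u (q 2 - y₀)) 0 u' p := by
  have h : HasPartials (fun q : Coord => q 2 - y₀) 0 1 p :=
    ((ContinuousLinearMap.proj 2 : Coord →L[ℝ] ℝ).hasFDerivAt.sub_const y₀).congr_fderiv (by simp)
  exact (comp hu h).congr (by ring) (by ring)

lemma add (hf : HasPartials f α β p) (hg : HasPartials g α' β' p) :
    HasPartials (fun q => f q + g q) (α + α') (β + β') p := by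
  refine (HasFDerivAt.fun_add hf hg).congr_fderiv ?_
  ext v
  simp
  ring

lemma mul (hf : HasPartials f α β p) (hg : HasPartials g α' β' p) :
    HasPartials (fun q => f q * g q) (α * g p + f p * α') (β * g p + f p * β') p := by
  refine (HasFDerivAt.fun_mul hf hg).congr_fderiv ?_
  ext v
  simp
  ring

lemma const_mul (k : ℝ) (hf : HasPartials f α β p) :
    HasPartials (fun q => k * f q) (k * α) (k * β) p := by
  refine (HasFDerivAt.const_mul hf k).congr_fderiv ?_
  ext v
  simp
  ring

lemma sub (hf : HasPartials f α β p) (hg : HasPartials g α' β' p) :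
    HasPartials (fun q => f q - g q) (α - α') (β - β') p := by
  refine (HasFDerivAt.fun_sub hf hg).congr_fderiv ?_
  ext v
  simp
  ring

lemma div (hf : HasPartials f α β p) (hg : HasPartials g α' β' p) (h0 : g p ≠ 0) :
    HasPartials (fun q => f q / g q) ((α * g p - f p * α') / g p ^ 2)
      ((β * g p - f p * β') / g p ^ 2) p := by
  refine (hf.mul (comp (hasDerivAt_inv h0) hg)).congr ?_ ?_ <;>
  · field_simp
    ring

end HasPartials

/-- The one-form `P dx + Q dy`. -/
noncomputable def oneForm (P Q : Coord → ℝ) (r : Coord) : Coord →L[ℝ] ℝ :=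
  P r • (ContinuousLinearMap.proj 1 : Coord →L[ℝ] ℝ)
    + Q r • (ContinuousLinearMap.proj 2 : Coord →L[ℝ] ℝ)

/-- Poincaré lemma for the one-forms `P dx + Q dy` in coordinate space. -/
lemma exists_primitive {B : Set Coord} (hB : Convex ℝ B) (hBo : IsOpen B) {P Q : Coord → ℝ}
    (hP : ContDiffOn ℝ ∞ P B) (hQ : ContDiffOn ℝ ∞ Q B)
    (hclosed : ∀ r ∈ B, ∃ α β γ, HasPartials P α β r ∧ HasPartials Q β γ r) :
    ∃ φ : Coord → ℝ, ContDiffOn ℝ ∞ φ B ∧ ∀ r ∈ B, HasPartials φ (P r) (Q r) r := by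
  have hω : ContDiffOn ℝ ∞ (oneForm P Q) B :=
    (hP.smul contDiffOn_const).add (hQ.smul contDiffOn_const)
  obtain ⟨φ, hφ⟩ := hB.exists_forall_hasFDerivAt_of_fderiv_symmetric hBo
    (hω.differentiableOn (by simp)) (by
      intro r hr v w
      obtain ⟨α, β, γ, hα, hγ⟩ := hclosed r hr
      have h : HasFDerivAt (oneForm P Q) _ r :=
        (HasFDerivAt.smul_const hα (ContinuousLinearMap.proj 1 : Coord →L[ℝ] ℝ)).add
          (HasFDerivAt.smul_const hγ (ContinuousLinearMap.proj 2 : Coord →L[ℝ] ℝ))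
      rw [h.fderiv]
      simp
      ring)
  refine ⟨φ, (contDiffOn_infty_iff_fderiv_of_isOpen hBo).2
    ⟨fun r hr => (hφ r hr).differentiableAt.differentiableWithinAt, ?_⟩, hφ⟩
  exact hω.congr fun r hr => (hφ r hr).fderiv

/-! ### The model metric and its pullback. -/

/-- The homogeneous model metric with constants `l = -2ω` and `m = m²`, in coordinates
`(T, a, b, z, u)` around the origin. -/
noncomputable def modelForm (l m : ℝ) (r v w : Coord) : ℝ :=
  -- With e² - m(a² + b²) = 1, the surface metric da² + db² - m(a da + b db)²/e² has curvature -m,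
  -- and (a db - b da)/(1 + e) is a primitive of its area form.
  let e := √(1 + m * (r 1 ^ 2 + r 2 ^ 2))
  (v 0 + l * (r 1 * v 2 - r 2 * v 1) / (1 + e)) * (w 0 + l * (r 1 * w 2 - r 2 * w 1) / (1 + e))
    - (v 1 * w 1 + v 2 * w 2 - m * (r 1 * v 1 + r 2 * v 2) * (r 1 * w 1 + r 2 * w 2) / e ^ 2)
    - v 3 * w 3 - v 4 * w 4

lemma modelForm_zero_left (l m : ℝ) (r w : Coord) : modelForm l m r 0 w = 0 := by
  simp [modelForm]

/-- The metric is the pullback of the model metric, as an identity between the coefficients: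
`a`, `b`, `e` and their partial derivatives are written out in terms of the fundamental
solutions. -/
lemma modelForm_pullback {l m C S κ σ δ D₀ D D₁ h : ℝ} (hC : C ^ 2 - m * S ^ 2 = 1)
    (hσ : σ ^ 2 = 2 * κ - (δ ^ 2 - m * D₀ ^ 2) * κ ^ 2) (hD : D = D₀ * C + δ * S)
    (hD₁ : D₁ = δ * C + m * D₀ * S) (he : 0 < C + m * D₀ * (D * κ)) {r v w V W : Coord}
    (hr1 : r 1 = S - δ * (D * κ)) (hr2 : r 2 = D * σ)
    (hV : V = ![v 0 + l * D₀ * σ / (1 + (C + m * D₀ * (D * κ))) * v 1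
        + (h - l * D * (S - (δ ^ 2 - m * D₀ ^ 2) * S * κ + δ * (D * κ))
          / (1 + (C + m * D₀ * (D * κ)))) * v 2,
      (C - δ * (D₁ * κ)) * v 1 + -(δ * (D * σ)) * v 2,
      D₁ * σ * v 1 + D * (1 - (δ ^ 2 - m * D₀ ^ 2) * κ) * v 2, v 3, v 4])
    (hW : W = ![w 0 + l * D₀ * σ / (1 + (C + m * D₀ * (D * κ))) * w 1
        + (h - l * D * (S - (δ ^ 2 - m * D₀ ^ 2) * S * κ + δ * (D * κ))
          / (1 + (C + m * D₀ * (D * κ)))) * w 2,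
      (C - δ * (D₁ * κ)) * w 1 + -(δ * (D * σ)) * w 2,
      D₁ * σ * w 1 + D * (1 - (δ ^ 2 - m * D₀ ^ 2) * κ) * w 2, w 3, w 4]) :
    modelForm l m r V W = metricForm h D v w := by
  set e := C + m * D₀ * (D * κ) with he_def
  set c := δ ^ 2 - m * D₀ ^ 2 with hc_def
  have he2 : 1 + m * (r 1 ^ 2 + r 2 ^ 2) = e ^ 2 := by
    rw [hr1, hr2, he_def]
    linear_combination -hC + m * D ^ 2 * hσ + 2 * m * κ * D * hD
  have hsqrt : √(1 + m * (r 1 ^ 2 + r 2 ^ 2)) = e := by rw [he2, Real.sqrt_sq he.le]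
  have h1e : 1 + e ≠ 0 := by positivity
  -- This is a da + b db; the factor e cancels the e² in the denominator of the model.
  have hrad : ∀ x y : ℝ, r 1 * ((C - δ * (D₁ * κ)) * x + -(δ * (D * σ)) * y)
      + r 2 * (D₁ * σ * x + D * (1 - c * κ) * y)
      = e * ((S + D₀ * (D₁ * κ)) * x + D₀ * (D * σ) * y) := by
    intro x y
    rw [hr1, hr2, he_def, hc_def]
    subst hD hD₁
    linear_combination (x * (δ * C + m * D₀ * S) * (D₀ * C + δ * S)) * hσ
  -- This is a db - b da, whose coefficients reappear in the time component of V and W.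
  have hang : ∀ x y : ℝ, r 1 * (D₁ * σ * x + D * (1 - c * κ) * y)
      - r 2 * ((C - δ * (D₁ * κ)) * x + -(δ * (D * σ)) * y)
      = -(D₀ * σ) * x + D * (S - c * S * κ + δ * (D * κ)) * y := by
    intro x y
    rw [hr1, hr2, hc_def]
    subst hD hD₁
    linear_combination (-(D₀ * σ) * x) * hC + y * δ * (D₀ * C + δ * S) ^ 2 * hσ
  -- The surface part of the model pulls back to dx² + D² dy².
  have hquad : ((C - δ * (D₁ * κ)) * v 1 + -(δ * (D * σ)) * v 2)
        * ((C - δ * (D₁ * κ)) * w 1 + -(δ * (D * σ)) * w 2)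
      + (D₁ * σ * v 1 + D * (1 - c * κ) * v 2) * (D₁ * σ * w 1 + D * (1 - c * κ) * w 2)
      - m * ((S + D₀ * (D₁ * κ)) * v 1 + D₀ * (D * σ) * v 2)
        * ((S + D₀ * (D₁ * κ)) * w 1 + D₀ * (D * σ) * w 2) = v 1 * w 1 + D ^ 2 * (v 2 * w 2) := by
    have h11 : (C - δ * (D₁ * κ)) ^ 2 + (D₁ * σ) ^ 2 - m * (S + D₀ * (D₁ * κ)) ^ 2 = 1 := by
      rw [hc_def] at *
      subst hD hD₁
      linear_combination hC + (δ * C + m * D₀ * S) ^ 2 * hσ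
    have h12 : (C - δ * (D₁ * κ)) * -(δ * (D * σ)) + D₁ * σ * (D * (1 - c * κ))
        - m * (S + D₀ * (D₁ * κ)) * (D₀ * (D * σ)) = 0 := by
      rw [hc_def, hD₁]
      ring
    have h22 : (δ * (D * σ)) ^ 2 + (D * (1 - c * κ)) ^ 2 - m * (D₀ * (D * σ)) ^ 2 = D ^ 2 := by
      rw [hc_def]
      linear_combination D ^ 2 * (δ ^ 2 - m * D₀ ^ 2) * hσ
    linear_combination v 1 * w 1 * h11 + (v 1 * w 2 + v 2 * w 1) * h12 + v 2 * w 2 * h22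
  have hV0 : V 0 + l * (r 1 * V 2 - r 2 * V 1) / (1 + e) = v 0 + h * v 2 := by
    simp only [hV, Matrix.cons_val]
    rw [hang]
    field_simp
    ring
  have hW0 : W 0 + l * (r 1 * W 2 - r 2 * W 1) / (1 + e) = w 0 + h * w 2 := by
    simp only [hW, Matrix.cons_val]
    rw [hang]
    field_simp
    ring
  simp only [modelForm, hsqrt, hV0, hW0, metricForm_apply]
  simp only [hV, hW, Matrix.cons_val]
  rw [hrad, hrad]
  have hdiv : ∀ x y : ℝ, m * (e * x) * (e * y) / e ^ 2 = m * x * y := by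
    intro x y
    field_simp
  rw [hdiv, hquad]
  ring



/-! ### Construction of the charts, and sufficiency. -/

lemma contDiff_comp_x {f : ℝ → ℝ} (hf : ContDiff ℝ ∞ f) (x₀ : ℝ) :
    ContDiff ℝ ∞ fun r : Coord => f (r 1 - x₀) :=
  hf.comp ((contDiff_apply ℝ ℝ (1 : Fin 5)).sub contDiff_const)

lemma contDiff_comp_y {f : ℝ → ℝ} (hf : ContDiff ℝ ∞ f) (y₀ : ℝ) :
    ContDiff ℝ ∞ fun r : Coord => f (r 2 - y₀) :=
  hf.comp ((contDiff_apply ℝ ℝ (2 : Fin 5)).sub contDiff_const)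

/-- The one-form `P dx + Q dy` that corrects the time coordinate is closed. -/
lemma closedness_identity {l m C S κ σ δ D₀ c D D₁ e e₁ n n₁ : ℝ} (hC : C ^ 2 - m * S ^ 2 = 1)
    (hc : c = δ ^ 2 - m * D₀ ^ 2) (hσ : σ ^ 2 = 2 * κ - c * κ ^ 2) (hD : D = D₀ * C + δ * S)
    (hD₁ : D₁ = δ * C + m * D₀ * S) (he : e = C + m * D₀ * (D * κ))
    (he₁ : e₁ = m * S + m * D₀ * (D₁ * κ)) (hn : n = S - c * S * κ + δ * (D * κ))
    (hn₁ : n₁ = C - c * C * κ + δ * (D₁ * κ)) (h0 : 1 + e ≠ 0) :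
    l * D - ((l * D₁ * n + l * D * n₁) * (1 + e) - l * D * n * e₁) / (1 + e) ^ 2 =
      (l * D₀ * (1 - c * κ) * (1 + e) - l * D₀ * σ * (m * D₀ * (D * σ))) / (1 + e) ^ 2 := by
  -- The closedness equation with the factor l and the denominator (1 + e)² removed; it holds modulo
  -- the two conserved quantities `hC` and `hσ`.
  have key : D₀ * (1 - c * κ) * (1 + e) - m * D₀ ^ 2 * D * σ ^ 2 + (D₁ * n + D * n₁) * (1 + e)
      - D * n * e₁ - D * (1 + e) ^ 2 = 0 := by
    subst hn hn₁ he he₁ hD hD₁ hc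
    linear_combination -m * D₀ ^ 2 * (D₀ * C + δ * S) * hσ + (S * δ - D₀ + κ * (C * δ ^ 2 * D₀
      + S * δ * D₀ ^ 2 * m + δ ^ 2 * D₀ - D₀ ^ 3 * m)) * hC
  field_simp
  linear_combination -l * key

/-- Around every point there is a chart in which the metric takes the model form. -/
lemma exists_chart {Ω : Set Coord} (hΩ : IsOpen Ω) (hΩc : IsConnected Ω) {H D D₁ : ℝ → ℝ}
    (hH : ContDiffOn ℝ ∞ H (xRange Ω)) {l m : ℝ} (dH : ∀ x ∈ xRange Ω, HasDerivAt H (l * D x) x)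
    (dD : ∀ x ∈ xRange Ω, HasDerivAt D (D₁ x) x)
    (dD₁ : ∀ x ∈ xRange Ω, HasDerivAt D₁ (m * D x) x) {p : Coord} (hp : p ∈ Ω) :
    ∃ (Ψ : Coord → Coord) (U : Set Coord), IsOpen U ∧ p ∈ U ∧ U ⊆ Ω ∧
      ContDiffOn ℝ ∞ Ψ U ∧ Ψ p = 0 ∧ ∀ r ∈ U, ∀ v w,
        modelForm l m (Ψ r) (fderiv ℝ Ψ r v) (fderiv ℝ Ψ r w)
          = metricForm (H (r 1)) (D (r 1)) v w := by
  obtain ⟨C, S, hC, hS, dC, dS, hC0, hS0⟩ := exists_cosh_sinh_like m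
  set δ := D₁ (p 1) with hδ
  set D₀ := D (p 1) with hD₀
  set c := δ ^ 2 - m * D₀ ^ 2 with hc
  obtain ⟨κ, σ, hκ, hσ, dκ, dσ, hκ0, hσ0⟩ := exists_versine_like c
  have hDeq : ∀ r ∈ Ω, D (r 1) = D₀ * C (r 1 - p 1) + δ * S (r 1 - p 1) := fun r hr =>
    eq_cosh_sinh_combination (isOpen_xRange hΩ) (isConnected_xRange hΩc).isPreconnected dC dS hC0
      hS0 dD dD₁ ⟨p, hp, rfl⟩ ⟨r, hr, rfl⟩
  -- The fundamental solutions as functions on coordinate space.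
  let fC : Coord → ℝ := fun r => C (r 1 - p 1)
  let fS : Coord → ℝ := fun r => S (r 1 - p 1)
  let fκ : Coord → ℝ := fun r => κ (r 2 - p 2)
  let fσ : Coord → ℝ := fun r => σ (r 2 - p 2)
  let fD : Coord → ℝ := fun r => D₀ * fC r + δ * fS r
  let fD₁ : Coord → ℝ := fun r => δ * fC r + m * D₀ * fS r
  -- On the quadric, y-translation acts by the linear field X: e' = m D₀ b, a' = -δ b, b' = D₀ e + δ
  -- a. Since X³ = -c X, its flow for time s is 1 + σ(s) X + κ(s) X². Applied to the geodesic (e, a,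
  -- b) = (C, S, 0) it gives `fe`, `fa`, `fb`.
  let fa : Coord → ℝ := fun r => fS r - δ * (fD r * fκ r)
  let fb : Coord → ℝ := fun r => fD r * fσ r
  let fe : Coord → ℝ := fun r => fC r + m * D₀ * (fD r * fκ r)
  let fn : Coord → ℝ := fun r => fS r - c * fS r * fκ r + δ * (fD r * fκ r)
  -- `fP` dx + `fQ` dy is H dy - l (a db - b da)/(1 + e), so adding its primitive to t turns dt + H
  -- dy into the one-form of the model.
  let fP : Coord → ℝ := fun r => l * D₀ * fσ r / (1 + fe r)
  let fQ : Coord → ℝ := fun r => H (r 1) - l * fD r * fn r / (1 + fe r)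
  have sC : ContDiff ℝ ∞ fC := contDiff_comp_x hC _
  have sS : ContDiff ℝ ∞ fS := contDiff_comp_x hS _
  have sκ : ContDiff ℝ ∞ fκ := contDiff_comp_y hκ _
  have sσ : ContDiff ℝ ∞ fσ := contDiff_comp_y hσ _
  have sD : ContDiff ℝ ∞ fD := by fun_prop
  have sa : ContDiff ℝ ∞ fa := by fun_prop
  have sb : ContDiff ℝ ∞ fb := by fun_prop
  have se : ContDiff ℝ ∞ fe := by fun_prop
  have sn : ContDiff ℝ ∞ fn := by fun_prop
  have pC : ∀ r, HasPartials fC (m * fS r) 0 r := fun r => .of_x (dC _)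
  have pS : ∀ r, HasPartials fS (fC r) 0 r := fun r => .of_x (dS _)
  have pκ : ∀ r, HasPartials fκ 0 (fσ r) r := fun r => .of_y (dκ _)
  have pσ : ∀ r, HasPartials fσ 0 (1 - c * fκ r) r := fun r => .of_y (dσ _)
  have pD : ∀ r, HasPartials fD (fD₁ r) 0 r := fun r =>
    (((pC r).const_mul D₀).add ((pS r).const_mul δ)).congr (by simp only [fD₁]; ring) (by ring)
  have pDκ : ∀ r, HasPartials (fun r => fD r * fκ r) (fD₁ r * fκ r) (fD r * fσ r) r := fun r =>
    ((pD r).mul (pκ r)).congr (by ring) (by ring)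
  have pa : ∀ r, HasPartials fa (fC r - δ * (fD₁ r * fκ r)) (-(δ * (fD r * fσ r))) r := fun r =>
    ((pS r).sub ((pDκ r).const_mul δ)).congr (by ring) (by ring)
  have pb : ∀ r, HasPartials fb (fD₁ r * fσ r) (fD r * (1 - c * fκ r)) r := fun r =>
    ((pD r).mul (pσ r)).congr (by ring) (by ring)
  have pe : ∀ r, HasPartials fe (m * fS r + m * D₀ * (fD₁ r * fκ r))
      (m * D₀ * (fD r * fσ r)) r := fun r =>
    ((pC r).add ((pDκ r).const_mul (m * D₀))).congr (by ring) (by ring)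
  have pn : ∀ r, HasPartials fn (fC r - c * fC r * fκ r + δ * (fD₁ r * fκ r))
      (-(c * fS r * fσ r) + δ * (fD r * fσ r)) r := fun r =>
    (((pS r).sub (((pS r).const_mul c).mul (pκ r))).add ((pDκ r).const_mul δ)).congr
      (by ring) (by ring)
  have qC : ∀ r, fC r ^ 2 - m * fS r ^ 2 = 1 := fun r => cosh_sq_like dC dS hC0 hS0 _
  have qσ : ∀ r, fσ r ^ 2 = 2 * fκ r - c * fκ r ^ 2 := fun r => versine_sq_like dκ dσ hκ0 hσ0 _
  have hCp : fC p = 1 := by simp [fC, hC0]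
  have hSp : fS p = 0 := by simp [fS, hS0]
  have hκp : fκ p = 0 := by simp [fκ, hκ0]
  have hσp : fσ p = 0 := by simp [fσ, hσ0]
  have hep : fe p = 1 := by simp [fe, hCp, hκp]
  -- A ball on which everything is defined.
  obtain ⟨ε, hε, hball⟩ : ∃ ε > 0, Metric.ball p ε ⊆ Ω ∩ {r | 0 < fe r} :=
    Metric.isOpen_iff.1 (hΩ.inter (isOpen_lt continuous_const se.continuous)) p
      ⟨hp, by simp [hep]⟩
  set U := Metric.ball p ε with hU
  have hUo : IsOpen U := Metric.isOpen_ball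
  have hne : ∀ r ∈ U, 1 + fe r ≠ 0 := fun r hr => by
    have : 0 < fe r := (hball hr).2
    positivity
  have p1e : ∀ r, HasPartials (fun r => 1 + fe r) (m * fS r + m * D₀ * (fD₁ r * fκ r))
      (m * D₀ * (fD r * fσ r)) r := fun r => HasFDerivAt.const_add 1 (pe r)
  have sH : ContDiffOn ℝ ∞ (fun r : Coord => H (r 1)) U :=
    hH.comp (contDiff_apply ℝ ℝ (1 : Fin 5)).contDiffOn fun r hr => ⟨r, (hball hr).1, rfl⟩
  have pH : ∀ r ∈ U, HasPartials (fun r : Coord => H (r 1)) (l * fD r) 0 r := by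
    intro r hr
    have h := HasPartials.of_x (p := r) (x₀ := 0) (u := H) (u' := l * D (r 1))
      (by simpa using dH _ ⟨r, (hball hr).1, rfl⟩)
    simp only [sub_zero] at h
    exact h.congr (by rw [hDeq r (hball hr).1]) rfl
  obtain ⟨φ, sφ, pφ⟩ := exists_primitive (B := U) (P := fP) (Q := fQ) (convex_ball p ε) hUo
    ((contDiff_const.mul sσ).contDiffOn.div (contDiff_const.add se).contDiffOn hne)
    (sH.sub (((contDiff_const.mul sD).mul sn).contDiffOn.div
      (contDiff_const.add se).contDiffOn hne)) (by
    intro r hr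
    have h1 := ((pσ r).const_mul (l * D₀)).div (p1e r) (hne r hr)
    have h2 := (pH r hr).sub ((((pD r).const_mul l).mul (pn r)).div (p1e r) (hne r hr))
    refine ⟨_, _, _, h1, h2.congr ?_ rfl⟩
    exact closedness_identity (qC r) hc (qσ r) rfl rfl rfl rfl rfl rfl (hne r hr))
  let Ψ : Coord → Coord := fun r => ![r 0 - p 0 + (φ r - φ p), fa r, fb r, r 3 - p 3, r 4 - p 4]
  refine ⟨Ψ, U, hUo, Metric.mem_ball_self hε, fun r hr => (hball hr).1, ?_, ?_, ?_⟩
  · rw [contDiffOn_pi]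
    intro i
    fin_cases i
    · exact (((contDiff_apply ℝ ℝ (0 : Fin 5)).sub contDiff_const).contDiffOn).add
        (sφ.sub contDiffOn_const)
    · exact sa.contDiffOn
    · exact sb.contDiffOn
    · exact ((contDiff_apply ℝ ℝ (3 : Fin 5)).sub contDiff_const).contDiffOn
    · exact ((contDiff_apply ℝ ℝ (4 : Fin 5)).sub contDiff_const).contDiffOn
  · ext i
    fin_cases i <;> simp [Ψ, fa, fb, hSp, hκp, hσp]
  · intro r hr v w
    have hproj : ∀ i : Fin 5, HasFDerivAt (fun q : Coord => q i - p i)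
        (ContinuousLinearMap.proj i : Coord →L[ℝ] ℝ) r := fun i =>
      (ContinuousLinearMap.proj i : Coord →L[ℝ] ℝ).hasFDerivAt.sub_const (p i)
    have hΨ : DifferentiableAt ℝ Ψ r := by
      rw [differentiableAt_pi]
      intro i
      fin_cases i
      · exact (hproj 0).differentiableAt.add (HasFDerivAt.sub_const _ (pφ r hr)).differentiableAt
      · exact (pa r).differentiableAt
      · exact (pb r).differentiableAt
      · exact (hproj 3).differentiableAt
      · exact (hproj 4).differentiableAt
    have hcomp : ∀ (i : Fin 5) (L : Coord →L[ℝ] ℝ), HasFDerivAt (fun q => Ψ q i) L r →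
        ∀ v, fderiv ℝ Ψ r v i = L v := fun i L hL v =>
      congrArg (fun K => K v) ((hasFDerivAt_pi'.1 hΨ.hasFDerivAt i).unique hL)
    have hΨv : ∀ v, fderiv ℝ Ψ r v = ![v 0 + fP r * v 1 + fQ r * v 2,
        (fC r - δ * (fD₁ r * fκ r)) * v 1 + -(δ * (fD r * fσ r)) * v 2,
        fD₁ r * fσ r * v 1 + fD r * (1 - c * fκ r) * v 2, v 3, v 4] := by
      intro v
      ext i
      fin_cases i
      · refine (hcomp 0 _ ((hproj 0).add (HasFDerivAt.sub_const _ (pφ r hr))) v).trans ?_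
        simp
        ring
      · exact (hcomp 1 _ (pa r) v).trans (by simp)
      · exact (hcomp 2 _ (pb r) v).trans (by simp)
      · exact hcomp 3 _ (hproj 3) v
      · exact hcomp 4 _ (hproj 4) v
    rw [hDeq r (hball hr).1]
    exact modelForm_pullback (qC r) (qσ r) rfl rfl (hball hr).2 rfl rfl (hΨv v) (hΨv w)

theorem locallyHomogeneous_of_constants {Ω : Set Coord} (hΩ : IsOpen Ω) (hΩc : IsConnected Ω)
    {H G D D₁ : ℝ → ℝ} (hH : ContDiffOn ℝ ∞ H (xRange Ω)) {l m : ℝ}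
    (dH : ∀ x ∈ xRange Ω, HasDerivAt H (l * D x) x)
    (dD : ∀ x ∈ xRange Ω, HasDerivAt D (D₁ x) x)
    (dD₁ : ∀ x ∈ xRange Ω, HasDerivAt D₁ (m * D x) x) (hD0 : ∀ x ∈ xRange Ω, D x ≠ 0)
    (hD2 : ∀ x ∈ xRange Ω, D x ^ 2 = G x + H x ^ 2) : LocallyHomogeneous (metric H G) Ω := by
  have hg : ∀ p ∈ Ω, ∀ v w, metric H G p v w = metricForm (H (p 1)) (D (p 1)) v w :=
    fun p hp => metric_eq_metricForm (hD2 _ ⟨p, hp, rfl⟩)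
  refine locallyHomogeneous_of_charts (fun p hp v hv => ?_) (modelForm l m)
    (modelForm_zero_left l m) (fun p hp => ?_)
  · exact metricForm_nondegenerate (hD0 _ ⟨p, hp, rfl⟩) v fun w => by rw [← hg p hp, hv]
  · obtain ⟨Ψ, U, hU, hpU, hUΩ, hΨ, hΨp, hmet⟩ := exists_chart hΩ hΩc hH dH dD dD₁ hp
    exact ⟨Ψ, U, hU, hpU, hUΩ, hΨ, hΨp, fun r hr v w => by rw [hmet r hr, hg r (hUΩ hr)]⟩

end GodelType

theorem theorem1 (Ω : Set GodelType.Coord) (hΩ : IsOpen Ω) (hΩc : IsConnected Ω)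
    (H G D : ℝ → ℝ)
    (hH : ContDiffOn ℝ ∞ H (GodelType.xRange Ω))
    (hG : ContDiffOn ℝ ∞ G (GodelType.xRange Ω))
    (hpos : ∀ x ∈ GodelType.xRange Ω, 0 < G x + H x ^ 2)
    (hD : ContinuousOn D (GodelType.xRange Ω))
    (hD2 : ∀ x ∈ GodelType.xRange Ω, D x ^ 2 = G x + H x ^ 2) :
    GodelType.LocallyHomogeneous (GodelType.metric H G) Ω ↔
      ∃ w m2 : ℝ, ∀ x ∈ GodelType.xRange Ω,
        deriv H x / D x = -2 * w ∧ deriv (deriv D) x / D x = m2 := by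
  have hI := GodelType.isOpen_xRange hΩ
  have hD' : ContDiffOn ℝ ∞ D (GodelType.xRange Ω) :=
    GodelType.contDiffOn_of_sq hI (hG.add (hH.pow 2)) hpos hD hD2
  have hD0 : ∀ x ∈ GodelType.xRange Ω, D x ≠ 0 := fun x hx h => by
    have := hpos x hx
    rw [← hD2 x hx, h] at this
    simp at this
  constructor
  · intro hom
    obtain ⟨x₀, hx₀⟩ := (GodelType.isConnected_xRange hΩc).nonempty
    refine ⟨-(deriv H x₀ / D x₀) / 2, deriv (deriv D) x₀ / D x₀, fun x hx => ?_⟩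
    obtain ⟨h1, h2⟩ :=
      GodelType.constants_of_locallyHomogeneous hΩ hΩc hH hD' hD0 hD2 hom hx hx₀
    exact ⟨by rw [h1]; ring, h2⟩
  · rintro ⟨w, m2, h⟩
    refine GodelType.locallyHomogeneous_of_constants hΩ hΩc (D₁ := deriv D) hH (l := -2 * w)
      (m := m2) (fun x hx => ?_) (fun x hx => GodelType.hasDerivAt_of_contDiffOn hI hD' hx)
      (fun x hx => ?_) hD0 hD2
    · exact (GodelType.hasDerivAt_of_contDiffOn hI hH hx).congr_deriv
        ((div_eq_iff (hD0 x hx)).1 (h x hx).1)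
    · exact (GodelType.hasDerivAt_of_contDiffOn hI
        (GodelType.contDiffOn_deriv hI hD') hx).congr_deriv
        ((div_eq_iff (hD0 x hx)).1 (h x hx).2)
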